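/- **Setting.** Let $\alpha = \tfrac{1}{\sqrt 2}$ and $\nu_\natural = \tfrac{\pi}{4}$. Let $u_\natural = \mathbf 1_{[-\alpha,\alpha]} \in L^2(\mathbb R)$ and $X_\natural(s,t) = \mathbf 1\{|s|\le\alpha,\ |t|\le\alpha\}$ on $\mathbb R^2$; let $\tau_\nu(s,t) = (s\cos\nu - t\sin\nu,\ s\sin\nu + t\cos\nu)$. For $\sigma>0$ let $\varphi_{\sigma^2}(s,t) = (2\pi\sigma^2)^{-1} e^{-(s^2+t^2)/(2\sigma^2)}$, and for $u\in L^2(\mathbb R)$, $\nu\in\mathbb R$ define the smoothed alignment loss $$\mathcal L^\sigma(\nu,u) = \tfrac12 \bigl\| \varphi_{\sigma^2} * \bigl( X_\natural\circ\tau_{\nu-\nu_\natural} - u u^*\bigr)\bigr\|_{L^2(\mathbb R^2)}^2, \qquad (uu^*)(s,t) = u(s)u(t).$$ For $\nu\in\mathbb R$ let $\mathcal T_\nu : L^2(\mathbb R)\to L^2(\mathbb R)$ be the integral operator $\mathcal T_\nu[f](s) = \int_{\mathbb R} (X_\natural\circ\tau_{\nu-\nu_\natural})(s,t) f(t)\,dt$,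 and put $A_\nu = \mathcal T_\nu + \mathcal T_\nu^*$. For $u_0\in L^2(\mathbb R)$ and $k\in\mathbb N$ define the power method output $$\mathsf P(k,u_0,\nu) = \sqrt{\tfrac12\langle u_k, A_\nu u_k\rangle_{L^2}}\; u_k, \qquad u_{j+1} = \frac{A_\nu u_j}{\|A_\nu u_j\|_{L^2}}, \quad 0\le j<k.$$ **Algorithm.** Given a smoothing level $\sigma>0$, a step size $\beta>0$ and iteration counts $T_{\mathrm{rough}}, T_\nu, T_u\in\mathbb N$: 1. (rough representation) $u_{\mathrm{rough}} = \mathsf P(T_{\mathrm{rough}}, \mathbf 1_{[-1,1]}, 0)$; 2. (alignment) draw $\nu_0$ uniformly from $[0,2\pi]$, set $\nu_{k+1} = \nu_k - \beta\,\partial_\nu \mathcal L^\sigma(\nu_k, u_{\mathrm{rough}})$ for $0\le k<T_\nu$, and $\hat\nu = \nu_{T_\nu}$; 3. (refined representation) $\hat u = \mathsf P(T_u, u_{\mathrm{rough}}, \hat\nu)$. **Theorem.** There are absolute constants $c_1, C_1, C_2>0$ such that the following holds. Let $\sigma>0$ and $\beta>0$ satisfy $\sigma^2\le 10^{-4}$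 and $\beta\le c_1$, let $0<\varepsilon\le\tfrac1{768}$, and suppose that $$T_{\mathrm{rough}} \ge -C_1\log(\sigma^2\varepsilon), \qquad T_\nu \ge -\frac{C_2\log(3\varepsilon)}{\beta}, \qquad T_u\ge 16.$$ Then with probability at least $4/7$ over $\nu_0$, both $$\min\Bigl\{ |\hat\nu-\nu_\natural| \bmod \tfrac\pi2,\ \ \tfrac\pi2 - \bigl(|\hat\nu-\nu_\natural| \bmod \tfrac\pi2\bigr)\Bigr\} \le 3\varepsilon \qquad\text{and}\qquad \|\hat u - u_\natural\|_{L^2(\mathbb R)} \le 31\sqrt{\varepsilon},$$ where $x \bmod p$ denotes the representative of $x$ modulo $p$ in $[0,p)$. -/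

import Mathlib

open MeasureTheory ProbabilityTheory
open scoped ENNReal InnerProductSpace Convolution

noncomputable section

namespace Tilted

/-- The real Hilbert space `L²(ℝ)`. -/
abbrev L2 : Type := Lp ℝ 2 (volume : Measure ℝ)

/-! ### Fredholm operators with square-integrable kernel -/

theorem ae_memLp_section {K : ℝ × ℝ → ℝ} (hK : MemLp K 2 volume) :
    ∀ᵐ s : ℝ, MemLp (fun t => K (s, t)) 2 volume := by
  have h1 : Integrable (fun x => K x ^ 2) ((volume : Measure ℝ).prod volume) :=
    hK.integrable_sq
  have h2 := h1.prod_right_ae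
  have h3 : ∀ᵐ s : ℝ, AEStronglyMeasurable (fun t => K (s, t)) volume := by
    have : AEStronglyMeasurable K ((volume : Measure ℝ).prod volume) := hK.1
    exact this.prodMk_left
  filter_upwards [h2, h3] with s hs hs'
  exact (memLp_two_iff_integrable_sq hs').2 hs

theorem eLpNorm_kernel_le {K : ℝ × ℝ → ℝ} (hK : MemLp K 2 volume) {f : ℝ → ℝ}
    (hf : MemLp f 2 volume) :
    eLpNorm (fun s => ∫ t, K (s, t) * f t) 2 volume ≤
      eLpNorm f 2 volume * eLpNorm K 2 volume := by
  have key : ∀ᵐ s : ℝ, ‖∫ t, K (s, t) * f t‖ₑ ≤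
      eLpNorm f 2 volume * eLpNorm (fun t => K (s, t)) 2 volume := by
    filter_upwards [ae_memLp_section hK] with s hs
    calc ‖∫ t, K (s, t) * f t‖ₑ ≤ ∫⁻ t, ‖K (s, t) * f t‖ₑ := enorm_integral_le_lintegral_enorm _
      _ = eLpNorm (f • fun t => K (s, t)) 1 volume := by
          rw [eLpNorm_one_eq_lintegral_enorm]
          refine lintegral_congr fun t => ?_
          rw [Pi.smul_apply', smul_eq_mul, mul_comm]
      _ ≤ eLpNorm f 2 volume * eLpNorm (fun t => K (s, t)) 2 volume :=
          eLpNorm_smul_le_mul_eLpNorm hs.1 hf.1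
  have hsq : ∀ (α : Type) [MeasurableSpace α] (μ : Measure α) (g : α → ℝ),
      eLpNorm g 2 μ ^ 2 = ∫⁻ x, ‖g x‖ₑ ^ 2 ∂μ := by
    intro α _ μ g
    rw [eLpNorm_eq_lintegral_rpow_enorm_toReal two_ne_zero ENNReal.ofNat_ne_top,
      ← ENNReal.rpow_natCast, ← ENNReal.rpow_mul]
    simp
  have hmeas : AEMeasurable (fun x => ‖K x‖ₑ ^ 2) ((volume : Measure ℝ).prod volume) := by
    have : AEStronglyMeasurable K ((volume : Measure ℝ).prod volume) := hK.1
    exact this.enorm.pow_const 2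
  have hfin : eLpNorm f 2 volume ^ 2 ≠ ∞ := ENNReal.pow_ne_top hf.2.ne
  have main : eLpNorm (fun s => ∫ t, K (s, t) * f t) 2 volume ^ 2 ≤
      (eLpNorm f 2 volume * eLpNorm K 2 volume) ^ 2 := by
    rw [hsq]
    calc ∫⁻ s, ‖∫ t, K (s, t) * f t‖ₑ ^ 2
        ≤ ∫⁻ s, eLpNorm f 2 volume ^ 2 * ∫⁻ t, ‖K (s, t)‖ₑ ^ 2 := by
          refine lintegral_mono_ae ?_
          filter_upwards [key] with s hs
          rw [← hsq, ← mul_pow]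
          gcongr
      _ = eLpNorm f 2 volume ^ 2 * ∫⁻ s, ∫⁻ t, ‖K (s, t)‖ₑ ^ 2 :=
          lintegral_const_mul' _ _ hfin
      _ = (eLpNorm f 2 volume * eLpNorm K 2 volume) ^ 2 := by
          rw [mul_pow, hsq _ _ K, Measure.volume_eq_prod, lintegral_prod _ hmeas]
  exact (ENNReal.pow_le_pow_left_iff two_ne_zero).1 main

theorem memLp_kernel {K : ℝ × ℝ → ℝ} (hK : MemLp K 2 volume) {f : ℝ → ℝ}
    (hf : MemLp f 2 volume) : MemLp (fun s => ∫ t, K (s, t) * f t) 2 volume := by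
  refine ⟨?_, (eLpNorm_kernel_le hK hf).trans_lt (ENNReal.mul_lt_top hf.2 hK.2)⟩
  have h1 : AEStronglyMeasurable K ((volume : Measure ℝ).prod volume) := hK.1
  have h2 : AEStronglyMeasurable (fun x : ℝ × ℝ => f x.2)
      ((volume : Measure ℝ).prod volume) := hf.1.comp_snd
  exact (h1.mul h2).integral_prod_right'

/-- The Fredholm operator `𝒯_K : L²(ℝ) → L²(ℝ)`, `𝒯_K[f](s) = ∫ K(s, t) f(t) dt`, of a kernel
`K ∈ L²(ℝ²)`. -/
def fredholm (K : ℝ × ℝ → ℝ) (hK : MemLp K 2 volume) : L2 →L[ℝ] L2 :=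
  LinearMap.mkContinuous
    { toFun := fun f => (memLp_kernel hK (Lp.memLp f)).toLp (fun s => ∫ t, K (s, t) * f t)
      map_add' := fun f g => by
        rw [← MemLp.toLp_add]
        refine MemLp.toLp_congr _ _ ?_
        filter_upwards [ae_memLp_section hK] with s hs
        have hf : Integrable (fun t => K (s, t) * f t) volume :=
          hs.integrable_mul (Lp.memLp f)
        have hg : Integrable (fun t => K (s, t) * g t) volume :=
          hs.integrable_mul (Lp.memLp g)
        rw [Pi.add_apply, ← integral_add hf hg]
        refine integral_congr_ae ?_
        filter_upwards [Lp.coeFn_add f g] with t ht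
        rw [ht, Pi.add_apply, mul_add]
      map_smul' := fun c f => by
        rw [RingHom.id_apply, ← MemLp.toLp_const_smul]
        refine MemLp.toLp_congr _ _ (Filter.Eventually.of_forall fun s => ?_)
        simp only [Pi.smul_apply, smul_eq_mul]
        rw [← integral_const_mul]
        refine integral_congr_ae ?_
        filter_upwards [Lp.coeFn_smul c f] with t ht
        rw [ht, Pi.smul_apply, smul_eq_mul]
        ring }
    (eLpNorm K 2 volume).toReal
    (fun f => by
      change ‖(memLp_kernel hK (Lp.memLp f)).toLp _‖ ≤ _
      rw [Lp.norm_toLp, Lp.norm_def, mul_comm, ← ENNReal.toReal_mul]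
      exact ENNReal.toReal_mono (ENNReal.mul_ne_top (Lp.memLp f).2.ne hK.2.ne)
        (eLpNorm_kernel_le hK (Lp.memLp f)))

/-! ### The model -/

/-- The rotation `τ_ν` of the plane by the angle `ν`. -/
def rot (ν : ℝ) (p : ℝ × ℝ) : ℝ × ℝ :=
  (Real.cos ν * p.1 - Real.sin ν * p.2, Real.sin ν * p.1 + Real.cos ν * p.2)

/-- The square template `X♮(s, t) = 1{|s| ≤ α, |t| ≤ α}`. -/
def template (α : ℝ) : ℝ × ℝ → ℝ :=
  Set.indicator {p : ℝ × ℝ | |p.1| ≤ α ∧ |p.2| ≤ α} (fun _ => 1)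

/-- The rotated template `X♮ ∘ τ_θ`. -/
def rotTemplate (α θ : ℝ) : ℝ × ℝ → ℝ := fun p => template α (rot θ p)

theorem memLp_rotTemplate (α θ : ℝ) : MemLp (rotTemplate α θ) 2 volume := by
  set S : Set (ℝ × ℝ) := {p | |(rot θ p).1| ≤ α ∧ |(rot θ p).2| ≤ α} with hS
  have hm : MeasurableSet S := by
    refine MeasurableSet.inter ?_ ?_
    · have : Measurable fun p : ℝ × ℝ => |(rot θ p).1| := by
        unfold rot
        fun_prop
      exact measurableSet_le this measurable_const
    · have : Measurable fun p : ℝ × ℝ => |(rot θ p).2| := by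
        unfold rot
        fun_prop
      exact measurableSet_le this measurable_const
  have hsub : S ⊆ Set.Icc (-(2 * α)) (2 * α) ×ˢ Set.Icc (-(2 * α)) (2 * α) := by
    rintro ⟨s, t⟩ ⟨h1, h2⟩
    simp only [rot] at h1 h2
    have ha : 0 ≤ α := (abs_nonneg _).trans h1
    have hc := Real.sin_sq_add_cos_sq θ
    rw [abs_le] at h1 h2
    have e1 : (Real.cos θ * s - Real.sin θ * t) ^ 2 ≤ α ^ 2 := sq_le_sq' h1.1 h1.2
    have e2 : (Real.sin θ * s + Real.cos θ * t) ^ 2 ≤ α ^ 2 := sq_le_sq' h2.1 h2.2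
    have e3 : s ^ 2 + t ^ 2 ≤ 2 * α ^ 2 := by
      have : s ^ 2 + t ^ 2 = (Real.cos θ * s - Real.sin θ * t) ^ 2
          + (Real.sin θ * s + Real.cos θ * t) ^ 2 := by
        linear_combination (-(s ^ 2 + t ^ 2)) * hc
      linarith
    have h3 : |s| ≤ 2 * α := abs_le_of_sq_le_sq (by nlinarith [sq_nonneg t]) (by linarith)
    have h4 : |t| ≤ 2 * α := abs_le_of_sq_le_sq (by nlinarith [sq_nonneg s]) (by linarith)
    exact ⟨abs_le.1 h3, abs_le.1 h4⟩
  have hfin : volume S ≠ ∞ := by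
    refine ((measure_mono hsub).trans_lt ?_).ne
    rw [Measure.volume_eq_prod, Measure.prod_prod]
    simp [ENNReal.mul_lt_top]
  have heq : rotTemplate α θ = S.indicator (fun _ => (1 : ℝ)) := by
    funext p
    simp [rotTemplate, template, Set.indicator, hS]
  rw [heq]
  exact memLp_indicator_const 2 hm 1 (Or.inr hfin)

/-- The indicator `1_{[-a, a]}`, as an element of `L²(ℝ)`. For `a = α` this is the target factor
`u♮`, and for `a = 1` it is the flat initialization `u₀`. -/
def pulse (a : ℝ) : L2 :=
  indicatorConstLp 2 (measurableSet_Icc : MeasurableSet (Set.Icc (-a) a))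
    measure_Icc_lt_top.ne (1 : ℝ)

/-- The Gaussian filter `φ_{σ²}` on the plane. -/
def gaussianFilter (σ : ℝ) (p : ℝ × ℝ) : ℝ :=
  (2 * Real.pi * σ ^ 2)⁻¹ * Real.exp (-(p.1 ^ 2 + p.2 ^ 2) / (2 * σ ^ 2))

/-- The smoothed alignment loss
`ℒ^σ(ν, u) = ½ ‖φ_{σ²} ∗ (X♮ ∘ τ_{ν - ν♮} - u u*)‖²` with the norm of `L²(ℝ²)`. -/
def loss (α νStar σ ν : ℝ) (u : L2) : ℝ :=
  (1 / 2) * ∫ x : ℝ × ℝ,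
    (gaussianFilter σ ⋆[ContinuousLinearMap.lsmul ℝ ℝ, volume]
      (fun p : ℝ × ℝ => rotTemplate α (ν - νStar) p - u p.1 * u p.2)) x ^ 2

/-! ### The algorithm -/

/-- `𝒯 + 𝒯*`, where `𝒯` is the Fredholm operator of the kernel `X♮ ∘ τ_{ν - ν♮}`. -/
def symOp (α νStar ν : ℝ) : L2 →L[ℝ] L2 :=
  fredholm (rotTemplate α (ν - νStar)) (memLp_rotTemplate α (ν - νStar)) +
    ContinuousLinearMap.adjoint
      (fredholm (rotTemplate α (ν - νStar)) (memLp_rotTemplate α (ν - νStar)))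

/-- The normalized power iterates of `A` from `u₀`: `u_{k+1} = A u_k / ‖A u_k‖`. -/
def powerIter (A : L2 →L[ℝ] L2) (u₀ : L2) : ℕ → L2
  | 0 => u₀
  | k + 1 => ‖A (powerIter A u₀ k)‖⁻¹ • A (powerIter A u₀ k)

/-- The output `P(k, u₀, ν)` of the power method: `√(½ ⟨u_k, (𝒯 + 𝒯*) u_k⟩) u_k`. -/
def powerMethod (α νStar : ℝ) (k : ℕ) (u₀ : L2) (ν : ℝ) : L2 :=
  Real.sqrt ((1 / 2) * ⟪powerIter (symOp α νStar ν) u₀ k,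
      symOp α νStar ν (powerIter (symOp α νStar ν) u₀ k)⟫_ℝ) •
    powerIter (symOp α νStar ν) u₀ k

/-- Stage one: the rough representation, from the flat initialization `u₀ = 1_{[-1, 1]}`. -/
def uRough (α νStar : ℝ) (Trough : ℕ) : L2 :=
  powerMethod α νStar Trough (pulse 1) 0

/-- Stage two: gradient descent with step size `β` on `ν ↦ ℒ^σ(ν, u)` from the angle `ν₀`. -/
def angleIter (α νStar σ β : ℝ) (u : L2) (ν₀ : ℝ) : ℕ → ℝ
  | 0 => ν₀
  | k + 1 => angleIter α νStar σ β u ν₀ k -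
      β * deriv (fun ν => loss α νStar σ ν u) (angleIter α νStar σ β u ν₀ k)

/-- The angle `ν̂` that stage two returns. -/
def nuHat (α νStar σ β : ℝ) (Trough Tν : ℕ) (ν₀ : ℝ) : ℝ :=
  angleIter α νStar σ β (uRough α νStar Trough) ν₀ Tν

/-- Stage three: the refined representation `û`. -/
def uHat (α νStar σ β : ℝ) (Trough Tν Tu : ℕ) (ν₀ : ℝ) : L2 :=
  powerMethod α νStar Tu (uRough α νStar Trough) (nuHat α νStar σ β Trough Tν ν₀)

/-- The representative of `x` modulo `p` in `[0, p)`. -/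
def realMod (x p : ℝ) : ℝ := x - p * ⌊x / p⌋

/-- The uniform probability distribution on `[0, 2π]`. -/
def uniformAngle : Measure ℝ := ProbabilityTheory.cond volume (Set.Icc 0 (2 * Real.pi))

end Tilted

end

/-!
The three stages of the algorithm are analysed separately.

*Rough representation.* At angle `0` the observed square is tilted by `π / 4`, that is, it is the
diamond `|s| + |t| ≤ 1`. Its kernel has the explicit eigenfunction `cosBump s = cos (π s / 2)` on
`[-1, 1]`, with eigenvalue `4 / π`, and the kernel left after removing this eigenpair has squared
Hilbert–Schmidt norm `2 - (4 / π)²`, which is less than `(2 / π)²` (`norm_diamondOp_le`). So each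
power step halves the relative error, and the last two applications of the integral operator turn
its `L²` norm into a bound on its sup and Lipschitz norms. The outcome (`exists_isProfile_uRough`)
is a multiple of `cosBump` plus a small Lipschitz error, a *profile* in the sense of `IsProfile`.

*Alignment.* By rotation invariance of the Gaussian, the loss is a constant minus the mass of
`w ⊗ w` on the rotated square, where `w` is the representation smoothed at variance `2 σ²`
(`exists_loss_eq`). The angular vector field is divergence free, so the derivative of that mass is
a boundary integral over the four edges, the *torque* (`hasDerivAt_integral_rotated`). Pairing the
points of an edge that are symmetric about its midpoint, the sign of the torque comes down to
comparing `cos (π s / 2) cos (π t / 2)` at two points of one circle. The sum and difference formulas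
turn this product into `½ (g (R + P) + g (R - P))` with `R = s² + t²`, `P = 2 s t` and
`g z = cos (π √z / 2)`, and `g` is strongly convex (`convexOn_cos_sqrt`), so the product is larger
where `|s t|` is. The gain dominates the profile and smoothing errors as long as the corners stay
away from the boundary of `[-1, 1]`, which holds for tilts `|θ| ≤ π / 7`. There the torque lies
between two negative multiples of `θ`, so gradient descent contracts the tilt geometrically
(`abs_add_mul_torque_le`). The intervals of half-width `π / 7` around the four aligned angles
`π / 4 + j π / 2` in `[0, 2 π]` have total probability `4 / 7` (`le_uniformAngle`).

*Refined representation.* At an angle within `3 ε` of alignment the operator is within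
`√(24 ε)` of the rank-one operator of `1_[-α, α]` in Hilbert–Schmidt norm, because the symmetric
difference of a square and its rotation by `θ` has area `O(|θ|)` (`norm_symOp_sub_le`). One power
step from a vector at a fixed angle to `1_[-α, α]` already lands at an angle `O(√ε)` from it,
further steps stay there, and the Rayleigh quotient supplies the scale
(`norm_powerMethod_sub_le`).
-/

noncomputable section

namespace Tilted

/-! ### Products of cosines on a circle -/

theorem cube_sub_le_sin_sub_mul_cos {x : ℝ} (hx : 0 ≤ x) :
    x ^ 3 / 3 - x ^ 5 / 30 ≤ Real.sin x - x * Real.cos x := by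
  have hd : ∀ y : ℝ, HasDerivAt
      (fun y => Real.sin y - y * Real.cos y - (y ^ 3 / 3 - y ^ 5 / 30))
      (y * (Real.sin y - (y - y ^ 3 / 6))) y := by
    intro y
    have h := ((Real.hasDerivAt_sin y).sub ((hasDerivAt_id y).mul (Real.hasDerivAt_cos y))).sub
      (((hasDerivAt_pow 3 y).div_const 3).sub ((hasDerivAt_pow 5 y).div_const 30))
    refine h.congr_deriv ?_
    simp only [id]
    push_cast
    ring
  have hmono : MonotoneOn (fun y => Real.sin y - y * Real.cos y - (y ^ 3 / 3 - y ^ 5 / 30))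
      (Set.Ici 0) := by
    refine monotoneOn_of_deriv_nonneg (convex_Ici 0)
      (fun y _ => (hd y).continuousAt.continuousWithinAt)
      (fun y _ => (hd y).differentiableAt.differentiableWithinAt) fun y hy => ?_
    rw [interior_Ici] at hy
    rw [(hd y).deriv]
    exact mul_nonneg (le_of_lt hy) (sub_nonneg.2 (Real.sin_ge_sub_cube (le_of_lt hy)))
  have h := hmono (Set.mem_Ici.2 le_rfl) (Set.mem_Ici.2 hx) hx
  simp at h
  linarith

/-- As a function of the squared radius, `cos (π r / 2)` is strongly convex on `r² ≤ 2`. -/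
theorem convexOn_cos_sqrt :
    ConvexOn ℝ (Set.Icc (0 : ℝ) 2) (fun z => Real.cos (Real.pi / 2 * √z) - z ^ 2 / 8) := by
  set a := Real.pi / 2 with ha
  have ha0 : 0 < a := by positivity
  have ha1 : 1.57 < a := by rw [ha]; linarith [Real.pi_gt_d2]
  have ha2 : a < 1.571 := by rw [ha]; linarith [Real.pi_lt_d4]
  refine convexOn_of_hasDerivWithinAt2_nonneg (convex_Icc 0 2)
    (f' := fun z => -Real.sin (a * √z) * (a * (1 / (2 * √z))) - z / 4)
    (f'' := fun z => a / (4 * √z ^ 3) * (Real.sin (a * √z) - a * √z * Real.cos (a * √z)) - 1 / 4)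
    (by fun_prop) ?_ ?_ ?_
  · intro z hz
    rw [interior_Icc] at hz
    refine HasDerivAt.hasDerivWithinAt ?_
    have h := (((Real.hasDerivAt_sqrt hz.1.ne').const_mul a).cos).sub
      ((hasDerivAt_pow 2 z).div_const 8)
    refine h.congr_deriv ?_
    push_cast
    ring
  · intro z hz
    rw [interior_Icc] at hz
    refine HasDerivAt.hasDerivWithinAt ?_
    have hr : 0 < √z := Real.sqrt_pos.2 hz.1
    have hs := Real.hasDerivAt_sqrt hz.1.ne'
    have h := ((((hs.const_mul a).sin).neg).mul
      (((hasDerivAt_const z (1 : ℝ)).div (hs.const_mul 2) (by positivity)).const_mul a)).sub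
      ((hasDerivAt_id z).div_const 4)
    refine h.congr_deriv ?_
    simp only [Pi.neg_apply, Pi.div_apply]
    field_simp
    ring
  · intro z hz
    rw [interior_Icc] at hz
    have hr : 0 < √z := Real.sqrt_pos.2 hz.1
    have hr2 : √z ^ 2 ≤ 2 := by rw [Real.sq_sqrt hz.1.le]; exact hz.2.le
    set r := √z
    have h := cube_sub_le_sin_sub_mul_cos (x := a * r) (by positivity)
    have h3 : a ^ 2 * r ^ 2 ≤ 4.94 := by nlinarith
    have h1 : r ^ 3 / a ≤ Real.sin (a * r) - a * r * Real.cos (a * r) := by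
      refine le_trans ?_ h
      rw [div_le_iff₀ ha0]
      have h2 : (1 : ℝ) ≤ a ^ 4 * (1 / 3 - (a * r) ^ 2 / 30) := by
        have h4 : (1.57 : ℝ) ^ 4 ≤ a ^ 4 := by gcongr
        have h5 : (0.168 : ℝ) ≤ 1 / 3 - (a * r) ^ 2 / 30 := by rw [mul_pow]; linarith
        nlinarith
      have h6 : 0 < r ^ 3 := by positivity
      calc r ^ 3 = r ^ 3 * 1 := by ring
        _ ≤ r ^ 3 * (a ^ 4 * (1 / 3 - (a * r) ^ 2 / 30)) := by gcongr
        _ = _ := by ring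
    have h7 : (1 : ℝ) / 4 = a / (4 * r ^ 3) * (r ^ 3 / a) := by field_simp
    have h8 : a / (4 * r ^ 3) * (r ^ 3 / a) ≤
      a / (4 * r ^ 3) * (Real.sin (a * r) - a * r * Real.cos (a * r)) := by gcongr
    linarith

theorem convexOn_add_le_add_of_abs_le {S : Set ℝ} {f : ℝ → ℝ} (hf : ConvexOn ℝ S f) {R P Q : ℝ}
    (h1 : R + P ∈ S) (h2 : R - P ∈ S) (hQ : |Q| ≤ P) :
    f (R + Q) + f (R - Q) ≤ f (R + P) + f (R - P) := by
  rcases (abs_nonneg Q |>.trans hQ).eq_or_lt with h0 | h0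
  · have : Q = 0 := abs_nonpos_iff.1 (h0 ▸ hQ)
    rw [this, ← h0]
  have hQ' := abs_le.1 hQ
  have e1 : 0 ≤ (P + Q) / (2 * P) := div_nonneg (by linarith) (by linarith)
  have e2 : 0 ≤ (P - Q) / (2 * P) := div_nonneg (by linarith) (by linarith)
  have e3 : (P + Q) / (2 * P) + (P - Q) / (2 * P) = 1 := by field_simp; ring
  have e4 : (P - Q) / (2 * P) + (P + Q) / (2 * P) = 1 := by field_simp; ring
  have k1 := hf.2 h1 h2 e1 e2 e3
  have k2 := hf.2 h1 h2 e2 e1 e4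
  simp only [smul_eq_mul] at k1 k2
  have r1 : (P + Q) / (2 * P) * (R + P) + (P - Q) / (2 * P) * (R - P) = R + Q := by
    field_simp; ring
  have r2 : (P - Q) / (2 * P) * (R + P) + (P + Q) / (2 * P) * (R - P) = R - Q := by
    field_simp; ring
  rw [r1] at k1
  rw [r2] at k2
  have r3 : (P - Q) / (2 * P) = 1 - (P + Q) / (2 * P) := by linarith
  rw [r3] at k1 k2
  linarith

/-- On a circle of radius at most `1` the product `cos (π s / 2) cos (π t / 2)` grows with `|s t|`,
quantitatively: the balanced point `p` has the larger value. -/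
theorem cos_mul_cos_sub_ge {p₁ p₂ q₁ q₂ : ℝ} (h : p₁ ^ 2 + p₂ ^ 2 = q₁ ^ 2 + q₂ ^ 2)
    (h1 : p₁ ^ 2 + p₂ ^ 2 ≤ 1) (hpq : |q₁ * q₂| ≤ p₁ * p₂) :
    1 / 2 * ((p₁ * p₂) ^ 2 - (q₁ * q₂) ^ 2) ≤
      Real.cos (Real.pi / 2 * p₁) * Real.cos (Real.pi / 2 * p₂) -
        Real.cos (Real.pi / 2 * q₁) * Real.cos (Real.pi / 2 * q₂) := by
  have key : ∀ s t : ℝ, Real.cos (Real.pi / 2 * √((s + t) ^ 2)) +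
      Real.cos (Real.pi / 2 * √((s - t) ^ 2)) =
      2 * (Real.cos (Real.pi / 2 * s) * Real.cos (Real.pi / 2 * t)) := by
    intro s t
    have e : ∀ x : ℝ, Real.cos (Real.pi / 2 * |x|) = Real.cos (Real.pi / 2 * x) := by
      intro x
      rw [← Real.cos_abs (Real.pi / 2 * x), abs_mul, abs_of_pos (by positivity : 0 < Real.pi / 2)]
    rw [Real.sqrt_sq_eq_abs, Real.sqrt_sq_eq_abs, e, e, mul_add, mul_sub, Real.cos_add,
      Real.cos_sub]
    ring
  have hQ : |2 * (q₁ * q₂)| ≤ 2 * (p₁ * p₂) := by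
    rw [abs_mul, abs_two]; linarith
  have hc := convexOn_add_le_add_of_abs_le convexOn_cos_sqrt (R := p₁ ^ 2 + p₂ ^ 2)
    (P := 2 * (p₁ * p₂))
    (Q := 2 * (q₁ * q₂)) ⟨by nlinarith [sq_nonneg (p₁ + p₂)], by nlinarith [sq_nonneg (p₁ - p₂)]⟩
    ⟨by nlinarith [sq_nonneg (p₁ - p₂)], by nlinarith [sq_nonneg (p₁ + p₂)]⟩ hQ
  have kp := key p₁ p₂
  have kq := key q₁ q₂
  rw [show (p₁ + p₂) ^ 2 = p₁ ^ 2 + p₂ ^ 2 + 2 * (p₁ * p₂) by ring,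
    show (p₁ - p₂) ^ 2 = p₁ ^ 2 + p₂ ^ 2 - 2 * (p₁ * p₂) by ring] at kp
  rw [show (q₁ + q₂) ^ 2 = q₁ ^ 2 + q₂ ^ 2 + 2 * (q₁ * q₂) by ring,
    show (q₁ - q₂) ^ 2 = q₁ ^ 2 + q₂ ^ 2 - 2 * (q₁ * q₂) by ring, ← h] at kq
  linarith

/-- The gain of `cos (π s / 2) cos (π t / 2)` between the two points of an edge of the rotated
square that are symmetric about its midpoint. -/
theorem cos_edge_gain {α θ y : ℝ} (hα : α ^ 2 = 1 / 2) (hα0 : 0 < α) (hy : 0 ≤ y) (hyα : y ≤ α)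
    (hθ : 0 ≤ θ) (hθ' : θ ≤ Real.pi / 4) :
    1 / 2 * (α * y * (α ^ 2 - y ^ 2) * Real.sin (4 * θ)) ≤
      Real.cos (Real.pi / 2 * (Real.cos θ * α - Real.sin θ * y)) *
          Real.cos (Real.pi / 2 * (Real.cos θ * y + Real.sin θ * α)) -
        Real.cos (Real.pi / 2 * (Real.cos θ * α + Real.sin θ * y)) *
          Real.cos (Real.pi / 2 * (Real.cos θ * y - Real.sin θ * α)) := by
  have hsc := Real.sin_sq_add_cos_sq θ
  have hs : 0 ≤ Real.sin θ := Real.sin_nonneg_of_nonneg_of_le_pi hθ (by linarith [Real.pi_pos])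
  have hs2 : 0 ≤ Real.sin (2 * θ) :=
    Real.sin_nonneg_of_nonneg_of_le_pi (by linarith) (by linarith [Real.pi_pos])
  have hc2 : 0 ≤ Real.cos (2 * θ) := Real.cos_nonneg_of_neg_pi_div_two_le_of_le
    (by linarith [Real.pi_pos]) (by linarith)
  have hs4 : Real.sin (4 * θ) = 2 * Real.sin (2 * θ) * Real.cos (2 * θ) := by
    rw [← Real.sin_two_mul]; ring_nf
  have e1 : Real.cos (2 * θ) = Real.cos θ ^ 2 - Real.sin θ ^ 2 := Real.cos_two_mul' θ
  have e2 : Real.sin (2 * θ) = 2 * Real.sin θ * Real.cos θ := Real.sin_two_mul θ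
  set c := Real.cos θ
  set s := Real.sin θ
  have hsq : 0 ≤ α ^ 2 - y ^ 2 := by nlinarith
  have hP : (c * α - s * y) * (c * y + s * α) =
      (α ^ 2 - y ^ 2) * Real.sin (2 * θ) / 2 + α * y * Real.cos (2 * θ) := by
    rw [e1, e2]; ring
  have hQ : (c * α + s * y) * (c * y - s * α) =
      -((α ^ 2 - y ^ 2) * Real.sin (2 * θ) / 2) + α * y * Real.cos (2 * θ) := by
    rw [e1, e2]; ring
  have n1 : 0 ≤ (α ^ 2 - y ^ 2) * Real.sin (2 * θ) / 2 := by positivity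
  have n2 : 0 ≤ α * y * Real.cos (2 * θ) := by positivity
  have := cos_mul_cos_sub_ge (p₁ := c * α - s * y) (p₂ := c * y + s * α) (q₁ := c * α + s * y)
    (q₂ := c * y - s * α) (by ring) (by nlinarith) (by
      rw [hP, hQ, abs_le]; constructor <;> linarith)
  refine le_trans (le_of_eq ?_) this
  rw [hP, hQ, hs4]
  ring

theorem two_mul_sin_le_sin_four_mul {θ : ℝ} (h0 : 0 ≤ θ) (h1 : θ ≤ Real.pi / 7) :
    2 * Real.sin θ ≤ Real.sin (4 * θ) := by
  have h2 : θ ≤ 0.449 := by linarith [Real.pi_lt_d4]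
  have hs : 0 ≤ Real.sin θ := Real.sin_nonneg_of_nonneg_of_le_pi h0 (by linarith [Real.pi_pos])
  have e : Real.sin (4 * θ) = Real.sin θ * (4 * Real.cos θ * Real.cos (2 * θ)) := by
    rw [show 4 * θ = 2 * (2 * θ) by ring, Real.sin_two_mul, Real.sin_two_mul]; ring
  have c1 := Real.one_sub_sq_div_two_le_cos (x := θ)
  have c2 := Real.one_sub_sq_div_two_le_cos (x := 2 * θ)
  have c3 : 0.89 ≤ Real.cos θ := by nlinarith
  have c4 : 0.59 ≤ Real.cos (2 * θ) := by nlinarith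
  rw [e]
  nlinarith [mul_le_mul c3 c4 (by norm_num) (by linarith)]

/-! ### Gaussian smoothing on the line -/

/-- The convolution of `f` with the centred Gaussian of variance `v`, written as an average. -/
def smooth (v : NNReal) (f : ℝ → ℝ) (x : ℝ) : ℝ := ∫ a, f (x + a) ∂gaussianReal 0 v

theorem integral_gaussianReal_neg (v : NNReal) (f : ℝ → ℝ) :
    ∫ a, f (-a) ∂gaussianReal 0 v = ∫ a, f a ∂gaussianReal 0 v := by
  have h := integral_map_equiv (μ := gaussianReal 0 v) (MeasurableEquiv.neg ℝ) f
  have h2 : Measure.map (MeasurableEquiv.neg ℝ) (gaussianReal 0 v) = gaussianReal 0 v := by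
    have := gaussianReal_map_neg (μ := 0) (v := v)
    rw [neg_zero] at this
    exact this
  rw [h2] at h
  exact h.symm

theorem smooth_eq_integral_sub (v : NNReal) (f : ℝ → ℝ) (x : ℝ) :
    smooth v f x = ∫ a, f (x - a) ∂gaussianReal 0 v := by
  rw [smooth, ← integral_gaussianReal_neg]
  simp only [sub_eq_add_neg]

theorem smooth_neg {v : NNReal} {f : ℝ → ℝ} (hf : ∀ x, f (-x) = f x) (x : ℝ) :
    smooth v f (-x) = smooth v f x := by
  rw [smooth_eq_integral_sub, smooth]
  refine integral_congr_ae (.of_forall fun a => ?_)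
  change f (-x - a) = f (x + a)
  rw [← hf]
  ring_nf

theorem integrable_gaussianReal_of_bound {v : NNReal} {f : ℝ → ℝ} (hf : Continuous f) {B : ℝ}
    (hB : ∀ x, |f x| ≤ B) : Integrable f (gaussianReal 0 v) :=
  Integrable.of_bound hf.aestronglyMeasurable B (.of_forall hB)

theorem abs_integral_gaussianReal_le {v : NNReal} {f : ℝ → ℝ} {B : ℝ} (hB : ∀ x, |f x| ≤ B) :
    |∫ a, f a ∂gaussianReal 0 v| ≤ B := by
  have := norm_integral_le_of_norm_le_const (μ := gaussianReal 0 v) (f := f) (C := B)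
    (.of_forall hB)
  simpa using this

theorem abs_smooth_le {v : NNReal} {f : ℝ → ℝ} {B : ℝ} (hB : ∀ x, |f x| ≤ B) (x : ℝ) :
    |smooth v f x| ≤ B := abs_integral_gaussianReal_le fun a => hB (x + a)

theorem abs_sub_le_of_lipschitzWith {f : ℝ → ℝ} {K : NNReal} (hf : LipschitzWith K f) (x y : ℝ) :
    |f x - f y| ≤ K * |x - y| := by
  simpa [Real.dist_eq] using hf.dist_le_mul x y

theorem lipschitzWith_smooth {v : NNReal} {f : ℝ → ℝ} {K : NNReal} (hf : LipschitzWith K f) {B : ℝ}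
    (hB : ∀ x, |f x| ≤ B) : LipschitzWith K (smooth v f) := by
  refine LipschitzWith.of_dist_le_mul fun x y => ?_
  have hc := hf.continuous
  rw [Real.dist_eq, Real.dist_eq, smooth, smooth, ← integral_sub
    (integrable_gaussianReal_of_bound (by fun_prop) fun a => hB _)
    (integrable_gaussianReal_of_bound (by fun_prop) fun a => hB _)]
  refine abs_integral_gaussianReal_le fun a => ?_
  simpa using abs_sub_le_of_lipschitzWith hf (x + a) (y + a)

/-- Gaussian smoothing turns a bounded Lipschitz function into a differentiable one, because a
Lipschitz function is differentiable almost everywhere and the Gaussian has a density. -/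
theorem differentiable_smooth {v : NNReal} (hv : v ≠ 0) {f : ℝ → ℝ} {K : NNReal}
    (hf : LipschitzWith K f) {B : ℝ} (hB : ∀ x, |f x| ≤ B) : Differentiable ℝ (smooth v f) := by
  intro x
  have hc := hf.continuous
  have hae : ∀ᵐ a ∂gaussianReal 0 v, DifferentiableAt ℝ f (x + a) := by
    refine (gaussianReal_absolutelyContinuous 0 hv).ae_le ?_
    exact (measurePreserving_add_left volume x).quasiMeasurePreserving.ae hf.ae_differentiableAt
  have h := hasDerivAt_integral_of_dominated_loc_of_lip (μ := gaussianReal 0 v) (x₀ := x)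
    (F := fun x a => f (x + a)) (F' := fun a => deriv f (x + a)) (s := Set.univ)
    (bound := fun _ => (K : ℝ)) Filter.univ_mem
    (.of_forall fun y => by
      have : Continuous fun a => f (y + a) := by fun_prop
      exact this.aestronglyMeasurable)
    (integrable_gaussianReal_of_bound (by fun_prop) fun a => hB _)
    ((measurable_deriv f).comp (measurable_const_add x)).aestronglyMeasurable
    (.of_forall fun a => by
      rw [lipschitzOnWith_univ]
      refine LipschitzWith.of_dist_le_mul fun y z => ?_
      have := abs_sub_le_of_lipschitzWith hf (y + a) (z + a)
      simpa [Real.dist_eq] using this)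
    (integrable_const _)
    (by
      filter_upwards [hae] with a ha
      exact ha.hasDerivAt.comp_add_const x a)
  exact h.2.differentiableAt

theorem smooth_smooth {v : NNReal} {f : ℝ → ℝ} (hf : Continuous f) {B : ℝ} (hB : ∀ x, |f x| ≤ B)
    (x : ℝ) : smooth v (smooth v f) x = smooth (v + v) f x := by
  have h := gaussianReal_conv_gaussianReal (m₁ := 0) (m₂ := 0) (v₁ := v) (v₂ := v)
  rw [add_zero] at h
  rw [smooth, smooth, ← h, integral_conv]
  · simp only [smooth, add_assoc]
  · exact Integrable.of_bound (by fun_prop) B (.of_forall fun a => hB _)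

theorem smooth_cos (v : NNReal) (a x : ℝ) :
    smooth v (fun z => Real.cos (a * z)) x = Real.exp (-(v * a ^ 2 / 2)) * Real.cos (a * x) := by
  have h1 : ∫ t, Real.sin (a * t) ∂gaussianReal 0 v = 0 := by
    have := integral_gaussianReal_neg v (fun t => Real.sin (a * t))
    simp only [mul_neg, Real.sin_neg, integral_neg] at this
    linarith
  have h2 : ∫ t, Real.cos (a * t) ∂gaussianReal 0 v = Real.exp (-(v * a ^ 2 / 2)) := by
    have h := charFun_gaussianReal (μ := 0) (v := v) a
    rw [charFun_apply_real] at h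
    have h3 := congrArg Complex.re h
    have hi : Integrable (fun t : ℝ => Complex.exp (a * t * Complex.I)) (gaussianReal 0 v) := by
      refine Integrable.of_bound (by fun_prop) 1 (.of_forall fun t => ?_)
      rw [← Complex.ofReal_mul, Complex.norm_exp_ofReal_mul_I]
    have h4 := Complex.reCLM.integral_comp_comm hi
    simp only [Complex.reCLM_apply] at h4
    rw [← h4] at h3
    have h5 : ∀ t : ℝ, (Complex.exp (a * t * Complex.I)).re = Real.cos (a * t) := by
      intro t
      rw [← Complex.ofReal_mul, Complex.exp_ofReal_mul_I_re]
    simp only [h5] at h3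
    rw [h3]
    have : (a : ℂ) * (0 : ℝ) * Complex.I - (v : ℝ) * (a : ℂ) ^ 2 / 2 =
      ((-(v * a ^ 2 / 2) : ℝ) : ℂ) := by push_cast; ring
    rw [this, Complex.exp_ofReal_re]
  have hb : ∀ g : ℝ → ℝ, (∀ t, |g t| ≤ 1) → Continuous g → Integrable g (gaussianReal 0 v) :=
    fun g h1 h2 => integrable_gaussianReal_of_bound h2 h1
  rw [smooth]
  simp only [mul_add, Real.cos_add]
  rw [integral_sub ((hb _ (fun t => Real.abs_cos_le_one _) (by fun_prop)).const_mul _)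
    ((hb _ (fun t => Real.abs_sin_le_one _) (by fun_prop)).const_mul _), integral_const_mul,
    integral_const_mul, h1, h2]
  ring

/-- A Chernoff bound, with exponent `250` optimal for the largest admissible variance. -/
theorem abs_integral_gaussianReal_le_of_eq_zero {v : NNReal} (hv : (v : ℝ) ≤ 2 / 10 ^ 4)
    {f : ℝ → ℝ} {D : ℝ} (hD : 0 ≤ D) (hf : ∀ a, |f a| ≤ D) (hf0 : ∀ a, |a| ≤ 1 / 20 → f a = 0) :
    |∫ a, f a ∂gaussianReal 0 v| ≤ D / 250 := by
  have hm : ∀ t : ℝ, ∫ a, Real.exp (t * a) ∂gaussianReal 0 v = Real.exp (v * t ^ 2 / 2) := by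
    intro t
    have := congrFun (mgf_id_gaussianReal (μ := 0) (v := v)) t
    simpa [mgf] using this
  have hint := fun t : ℝ => integrable_exp_mul_gaussianReal (μ := 0) (v := v) t
  have hI : Integrable (fun a => D * (Real.exp (-(25 / 2)) *
      (Real.exp (250 * a) + Real.exp (-250 * a)))) (gaussianReal 0 v) :=
    (((hint 250).add (hint (-250))).const_mul _).const_mul _
  have h1 : |∫ a, f a ∂gaussianReal 0 v| ≤ ∫ a, D * (Real.exp (-(25 / 2)) *
      (Real.exp (250 * a) + Real.exp (-250 * a))) ∂gaussianReal 0 v := by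
    refine norm_integral_le_of_norm_le (f := f) hI (.of_forall fun a => ?_)
    rw [Real.norm_eq_abs]
    rcases le_or_gt |a| (1 / 20) with ha | ha
    · rw [hf0 a ha, abs_zero]
      positivity
    · refine (hf a).trans (le_mul_of_one_le_right hD ?_)
      rw [mul_add, ← Real.exp_add, ← Real.exp_add]
      rcases lt_abs.1 ha with h | h
      · have : 1 ≤ Real.exp (-(25 / 2) + 250 * a) := Real.one_le_exp (by linarith)
        linarith [Real.exp_pos (-(25 / 2) + -250 * a)]
      · have : 1 ≤ Real.exp (-(25 / 2) + -250 * a) := Real.one_le_exp (by linarith)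
        linarith [Real.exp_pos (-(25 / 2) + 250 * a)]
  rw [integral_const_mul, integral_const_mul, integral_add (hint _) (hint _), hm, hm] at h1
  refine h1.trans ?_
  have h2 : Real.exp (v * 250 ^ 2 / 2) ≤ Real.exp (25 / 4) := Real.exp_le_exp.2 (by linarith)
  have h3 : Real.exp (v * (-250) ^ 2 / 2) ≤ Real.exp (25 / 4) := Real.exp_le_exp.2 (by linarith)
  have h4 : Real.exp (-(25 / 2)) * (Real.exp (25 / 4) + Real.exp (25 / 4)) ≤ 1 / 250 := by
    have e1 : Real.exp (-(25 / 2)) * (Real.exp (25 / 4) + Real.exp (25 / 4)) =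
        2 / Real.exp (25 / 4) := by
      rw [eq_div_iff (Real.exp_pos _).ne', ← two_mul,
        show Real.exp (-(25 / 2)) * (2 * Real.exp (25 / 4)) * Real.exp (25 / 4) =
          2 * (Real.exp (-(25 / 2)) * (Real.exp (25 / 4) * Real.exp (25 / 4))) by ring,
        ← Real.exp_add, ← Real.exp_add]
      norm_num
    have e2 : (500 : ℝ) ≤ Real.exp (25 / 4) := by
      have e3 : Real.exp (25 / 4) = Real.exp 1 ^ 6 * Real.exp (1 / 4) := by
        rw [← Real.exp_nat_mul, ← Real.exp_add]; norm_num
      have e4 : (403 : ℝ) ≤ Real.exp 1 ^ 6 := by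
        calc (403 : ℝ) ≤ 2.7182818283 ^ 6 := by norm_num
          _ ≤ _ := by gcongr; exact Real.exp_one_gt_d9.le
      have e5 : (1.25 : ℝ) ≤ Real.exp (1 / 4) := by
        have := Real.add_one_le_exp (1 / 4 : ℝ)
        linarith
      rw [e3]
      nlinarith
    rw [e1, div_le_div_iff₀ (Real.exp_pos _) (by norm_num)]
    linarith
  calc _ ≤ D * (Real.exp (-(25 / 2)) * (Real.exp (25 / 4) + Real.exp (25 / 4))) := by gcongr
    _ ≤ D * (1 / 250) := by gcongr
    _ = D / 250 := by ring

/-! ### Smoothing the truncated cosine -/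

/-- The half period of a cosine on `[-1, 1]`, extended by zero. -/
def cosBump (s : ℝ) : ℝ := if |s| ≤ 1 then Real.cos (Real.pi / 2 * s) else 0

theorem cosBump_eq (s : ℝ) : cosBump s = Real.cos (Real.pi / 2 * max (-1) (min 1 s)) := by
  unfold cosBump
  split_ifs with h
  · rw [abs_le] at h
    rw [min_eq_right h.2, max_eq_right h.1]
  · rcases lt_abs.1 (not_le.1 h) with h' | h'
    · rw [min_eq_left h'.le, max_eq_right (by norm_num), mul_one, Real.cos_pi_div_two]
    · rw [min_eq_right (by linarith), max_eq_left (by linarith), mul_neg_one, Real.cos_neg,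
        Real.cos_pi_div_two]

theorem abs_cos_sub_cos_le (x y : ℝ) :
    |Real.cos (Real.pi / 2 * x) - Real.cos (Real.pi / 2 * y)| ≤ Real.pi / 2 * |x - y| := by
  have h := Real.abs_cos_sub_cos_le (Real.pi / 2 * x) (Real.pi / 2 * y)
  rwa [← mul_sub, abs_mul, abs_of_pos (by positivity : 0 < Real.pi / 2)] at h

theorem abs_cosBump_sub_le (x y : ℝ) : |cosBump x - cosBump y| ≤ Real.pi / 2 * |x - y| := by
  rw [cosBump_eq, cosBump_eq]
  refine (abs_cos_sub_cos_le _ _).trans (mul_le_mul_of_nonneg_left ?_ (by positivity))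
  calc |max (-1) (min 1 x) - max (-1) (min 1 y)| ≤ |min 1 x - min 1 y| := by
        simpa using abs_max_sub_max_le_max (-1) (min 1 x) (-1) (min 1 y)
    _ ≤ |x - y| := by simpa using abs_min_sub_min_le_max 1 x 1 y

theorem continuous_cosBump : Continuous cosBump := by
  have : cosBump = fun s => Real.cos (Real.pi / 2 * max (-1) (min 1 s)) := funext cosBump_eq
  rw [this]
  fun_prop

theorem cosBump_neg (x : ℝ) : cosBump (-x) = cosBump x := by simp [cosBump]

theorem abs_cosBump_le (x : ℝ) : |cosBump x| ≤ 1 := by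
  rw [cosBump_eq]; exact Real.abs_cos_le_one _

theorem cosBump_eq_zero {x : ℝ} (hx : 1 < |x|) : cosBump x = 0 := by
  simp [cosBump, not_le.2 hx]

/-- `IsProfile m e` says that `m (cosBump + e)` is a representation close to the leading
eigenfunction `cosBump` of the kernel at angle zero: `m` is of order one, and the even error `e` is
small in the Lipschitz sense and supported in `[-1, 1]`. -/
structure IsProfile (m : ℝ) (e : ℝ → ℝ) : Prop where
  pos : 0 < m
  one_le : 1 ≤ m ^ 2
  le_two : m ^ 2 ≤ 2
  even : ∀ x, e (-x) = e x
  bound : ∀ x, |e x| ≤ 1 / 2000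
  lipschitz : ∀ x y, |e x - e y| ≤ 1 / 2000 * |x - y|
  support : ∀ x, 1 < |x| → e x = 0

/-- The profile `m (cosBump + e)`. -/
def profile (m : ℝ) (e : ℝ → ℝ) (x : ℝ) : ℝ := m * (cosBump x + e x)

theorem continuous_of_abs_sub_le {f : ℝ → ℝ} {K : ℝ} (hf : ∀ x y, |f x - f y| ≤ K * |x - y|) :
    Continuous f := by
  have : LipschitzWith (Real.toNNReal K) f := by
    refine LipschitzWith.of_dist_le' fun x y => ?_
    simpa [Real.dist_eq] using hf x y
  exact this.continuous

theorem abs_smooth_sub_le {v : NNReal} {f : ℝ → ℝ} {K B : ℝ}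
    (hf : ∀ x y, |f x - f y| ≤ K * |x - y|) (hB : ∀ x, |f x| ≤ B) (x y : ℝ) :
    |smooth v f x - smooth v f y| ≤ K * |x - y| := by
  have hc := continuous_of_abs_sub_le hf
  rw [smooth, smooth, ← integral_sub
    (integrable_gaussianReal_of_bound (by fun_prop) fun a => hB _)
    (integrable_gaussianReal_of_bound (by fun_prop) fun a => hB _)]
  refine abs_integral_gaussianReal_le fun a => ?_
  simpa using hf (x + a) (y + a)

/-- The difference between the smoothed normalized profile and the damped cosine. -/
def smoothError (v : NNReal) (e : ℝ → ℝ) (x : ℝ) : ℝ :=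
  smooth v (fun z => cosBump z - Real.cos (Real.pi / 2 * z)) x + smooth v e x

theorem IsProfile.continuous {m : ℝ} {e : ℝ → ℝ} (he : IsProfile m e) : Continuous e :=
  continuous_of_abs_sub_le he.lipschitz

theorem abs_cosBump_sub_cos_le (x : ℝ) : |cosBump x - Real.cos (Real.pi / 2 * x)| ≤ 1 := by
  unfold cosBump
  split_ifs
  · simp
  · simpa using Real.abs_cos_le_one _

theorem smooth_profile {m : ℝ} {e : ℝ → ℝ} (he : IsProfile m e) (v : NNReal) (x : ℝ) :
    smooth v (profile m e) x = m * (Real.exp (-(v * (Real.pi / 2) ^ 2 / 2)) *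
      Real.cos (Real.pi / 2 * x) + smoothError v e x) := by
  have h1 := continuous_cosBump
  have h2 := he.continuous
  have i1 : Integrable (fun a => cosBump (x + a) - Real.cos (Real.pi / 2 * (x + a)))
      (gaussianReal 0 v) := integrable_gaussianReal_of_bound (by fun_prop) fun a =>
        abs_cosBump_sub_cos_le _
  have i2 : Integrable (fun a => Real.cos (Real.pi / 2 * (x + a))) (gaussianReal 0 v) :=
    integrable_gaussianReal_of_bound (by fun_prop) fun a => Real.abs_cos_le_one _
  have i3 : Integrable (fun a => e (x + a)) (gaussianReal 0 v) :=
    integrable_gaussianReal_of_bound (by fun_prop) fun a => he.bound _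
  have i4 : Integrable (fun a => cosBump (x + a) - Real.cos (Real.pi / 2 * (x + a)) + e (x + a))
      (gaussianReal 0 v) := i1.add i3
  rw [← smooth_cos, smoothError, smooth, smooth, smooth, smooth, ← integral_add i1 i3,
    ← integral_add i2 i4, ← integral_const_mul]
  refine integral_congr_ae (.of_forall fun a => ?_)
  simp only [profile]
  ring

theorem cosBump_sub_cos_eq_zero {x a : ℝ} (hx : |x| ≤ 19 / 20) (ha : |a| ≤ 1 / 20) :
    cosBump (x + a) - Real.cos (Real.pi / 2 * (x + a)) = 0 := by
  have : |x + a| ≤ 1 := (abs_add_le x a).trans (by linarith)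
  simp [cosBump, this]

theorem abs_smoothError_le {m : ℝ} {e : ℝ → ℝ} (he : IsProfile m e) {v : NNReal}
    (hv : (v : ℝ) ≤ 2 / 10 ^ 4) {x : ℝ} (hx : |x| ≤ 19 / 20) :
    |smoothError v e x| ≤ 1 / 200 := by
  have h1 := abs_integral_gaussianReal_le_of_eq_zero hv zero_le_one
    (f := fun a => cosBump (x + a) - Real.cos (Real.pi / 2 * (x + a)))
    (fun a => abs_cosBump_sub_cos_le _) (fun a ha => cosBump_sub_cos_eq_zero hx ha)
  have h2 := abs_smooth_le (v := v) he.bound x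
  refine (abs_add_le _ _).trans ?_
  change |∫ a, _ ∂_| + _ ≤ _
  linarith

theorem abs_smoothError_sub_le {m : ℝ} {e : ℝ → ℝ} (he : IsProfile m e) {v : NNReal}
    (hv : (v : ℝ) ≤ 2 / 10 ^ 4) {x y : ℝ} (hx : |x| ≤ 19 / 20) (hy : |y| ≤ 19 / 20) :
    |smoothError v e x - smoothError v e y| ≤ 1 / 75 * |x - y| := by
  have hc := continuous_cosBump
  have hi : ∀ x, Integrable (fun a => cosBump (x + a) - Real.cos (Real.pi / 2 * (x + a)))
      (gaussianReal 0 v) := fun x =>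
    integrable_gaussianReal_of_bound (by fun_prop) fun a => abs_cosBump_sub_cos_le _
  have h1 := abs_integral_gaussianReal_le_of_eq_zero hv (D := Real.pi * |x - y|) (by positivity)
    (f := fun a => (cosBump (x + a) - Real.cos (Real.pi / 2 * (x + a))) -
      (cosBump (y + a) - Real.cos (Real.pi / 2 * (y + a))))
    (fun a => by
      have k1 := abs_cosBump_sub_le (x + a) (y + a)
      have k2 := abs_cos_sub_cos_le (x + a) (y + a)
      rw [show x + a - (y + a) = x - y by ring] at k1 k2
      rw [abs_le] at k1 k2 ⊢
      constructor <;> linarith)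
    (fun a ha => by
      rw [cosBump_sub_cos_eq_zero hx ha, cosBump_sub_cos_eq_zero hy ha, sub_zero])
  rw [integral_sub (hi x) (hi y)] at h1
  change |smooth v (fun z => cosBump z - Real.cos (Real.pi / 2 * z)) x -
    smooth v (fun z => cosBump z - Real.cos (Real.pi / 2 * z)) y| ≤ _ at h1
  have h2 := abs_smooth_sub_le (v := v) he.lipschitz he.bound x y
  have h3 : smoothError v e x - smoothError v e y =
      (smooth v (fun z => cosBump z - Real.cos (Real.pi / 2 * z)) x -
        smooth v (fun z => cosBump z - Real.cos (Real.pi / 2 * z)) y) +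
      (smooth v e x - smooth v e y) := by simp only [smoothError]; ring
  rw [h3]
  refine (abs_add_le _ _).trans ?_
  have h4 : Real.pi * |x - y| / 250 ≤ 3.1416 * |x - y| / 250 := by
    gcongr
    exact Real.pi_lt_d4.le
  have := abs_nonneg (x - y)
  linarith

/-! ### The torque on the rotated square -/

/-- If `g` is a damped cosine up to a perturbation that is small in the Lipschitz sense, then
`g ⊗ g` still gains between mirror points of an edge of the rotated square. -/
theorem edge_gain {α θ y κ : ℝ} {ρ : ℝ → ℝ} (hα : α ^ 2 = 1 / 2) (hα0 : 0 < α) (hy : 0 ≤ y)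
    (hyα : y ≤ α) (hθ : 0 ≤ θ) (hθ' : θ ≤ Real.pi / 7) (hκ : 0 ≤ κ) (hκ1 : κ ≤ 1)
    (hb : ∀ x, |x| ≤ 19 / 20 → |ρ x| ≤ 1 / 200)
    (hL : ∀ x x', |x| ≤ 19 / 20 → |x'| ≤ 19 / 20 → |ρ x - ρ x'| ≤ 1 / 75 * |x - x'|) :
    κ ^ 2 * (1 / 2 * (α * y * (α ^ 2 - y ^ 2) * (2 * Real.sin θ))) -
        0.0213 * (2 * Real.sin θ * (y + α)) ≤
      (κ * Real.cos (Real.pi / 2 * (Real.cos θ * α - Real.sin θ * y)) +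
          ρ (Real.cos θ * α - Real.sin θ * y)) *
        (κ * Real.cos (Real.pi / 2 * (Real.cos θ * y + Real.sin θ * α)) +
          ρ (Real.cos θ * y + Real.sin θ * α)) -
      (κ * Real.cos (Real.pi / 2 * (Real.cos θ * α + Real.sin θ * y)) +
          ρ (Real.cos θ * α + Real.sin θ * y)) *
        (κ * Real.cos (Real.pi / 2 * (Real.cos θ * y - Real.sin θ * α)) +
          ρ (Real.cos θ * y - Real.sin θ * α)) := by
  have hpi := Real.pi_lt_d4
  have hpi0 := Real.pi_pos
  have hs : 0 ≤ Real.sin θ := Real.sin_nonneg_of_nonneg_of_le_pi hθ (by linarith)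
  have hc : 0 ≤ Real.cos θ := Real.cos_nonneg_of_neg_pi_div_two_le_of_le
    (by linarith) (by linarith)
  have hsq : 0 ≤ α ^ 2 - y ^ 2 := by nlinarith
  have hgain := cos_edge_gain hα hα0 hy hyα hθ (by linarith)
  have hgain' : 1 / 2 * (α * y * (α ^ 2 - y ^ 2) * (2 * Real.sin θ)) ≤
      1 / 2 * (α * y * (α ^ 2 - y ^ 2) * Real.sin (4 * θ)) := by
    gcongr
    exact two_mul_sin_le_sin_four_mul hθ hθ'
  -- The four points stay at distance at least `1 / 20` from the kink of the profile at `±1`.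
  have hcs : (Real.cos θ * α + Real.sin θ * α) ≤ 19 / 20 := by
    have c2 := Real.one_sub_sq_div_two_le_cos (x := 2 * θ)
    have c3 : 0.596 ≤ Real.cos (2 * θ) := by nlinarith
    have c4 : Real.sin (2 * θ) ≤ 0.803 := by
      have := Real.sin_sq_add_cos_sq (2 * θ)
      nlinarith
    rw [Real.sin_two_mul] at c4
    have := Real.sin_sq_add_cos_sq θ
    refine le_of_sq_le_sq ?_ (by norm_num)
    nlinarith
  generalize Real.sin θ = s at *
  generalize Real.cos θ = c at *
  have hsy : s * y ≤ s * α := by gcongr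
  have hcy : c * y ≤ c * α := by gcongr
  have n1 : 0 ≤ s * y := by positivity
  have n2 : 0 ≤ c * y := by positivity
  have nsα : 0 ≤ s * α := by positivity
  have ncα : 0 ≤ c * α := by positivity
  have b1 : |c * α - s * y| ≤ 19 / 20 := abs_le.2 ⟨by linarith, by linarith⟩
  have b2 : |c * y + s * α| ≤ 19 / 20 := abs_le.2 ⟨by linarith, by linarith⟩
  have b3 : |c * α + s * y| ≤ 19 / 20 := abs_le.2 ⟨by linarith, by linarith⟩
  have b4 : |c * y - s * α| ≤ 19 / 20 := abs_le.2 ⟨by linarith, by linarith⟩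
  have d1 : |c * α - s * y - (c * α + s * y)| = 2 * (s * y) := by
    rw [show c * α - s * y - (c * α + s * y) = -(2 * (s * y)) by ring, abs_neg,
      abs_of_nonneg (by positivity)]
  have d2 : |c * y + s * α - (c * y - s * α)| = 2 * (s * α) := by
    rw [show c * y + s * α - (c * y - s * α) = 2 * (s * α) by ring, abs_of_nonneg (by positivity)]
  have l1 := hL _ _ b1 b3
  have l2 := hL _ _ b2 b4
  have k1 := abs_cos_sub_cos_le (c * α - s * y) (c * α + s * y)
  have k2 := abs_cos_sub_cos_le (c * y + s * α) (c * y - s * α)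
  rw [d1] at l1 k1
  rw [d2] at l2 k2
  have r1 := hb _ b1
  have r2 := hb _ b2
  have r3 := hb _ b3
  have r4 := hb _ b4
  have o2 := Real.abs_cos_le_one (Real.pi / 2 * (c * y + s * α))
  have o3 := Real.abs_cos_le_one (Real.pi / 2 * (c * α + s * y))
  generalize Real.cos (Real.pi / 2 * (c * α - s * y)) = C1 at *
  generalize Real.cos (Real.pi / 2 * (c * y + s * α)) = C2 at *
  generalize Real.cos (Real.pi / 2 * (c * α + s * y)) = C3 at *
  generalize Real.cos (Real.pi / 2 * (c * y - s * α)) = C4 at *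
  generalize ρ (c * α - s * y) = R1 at *
  generalize ρ (c * y + s * α) = R2 at *
  generalize ρ (c * α + s * y) = R3 at *
  generalize ρ (c * y - s * α) = R4 at *
  have k1' : |C1 - C3| ≤ 1.5708 * (2 * (s * y)) := k1.trans (by gcongr; linarith)
  have k2' : |C2 - C4| ≤ 1.5708 * (2 * (s * α)) := k2.trans (by gcongr; linarith)
  have step : ∀ {A B A' B' : ℝ}, |A| ≤ A' → |B| ≤ B' → |A * B| ≤ A' * B' := by
    intro A B A' B' h h'
    rw [abs_mul]
    exact mul_le_mul h h' (abs_nonneg _) ((abs_nonneg _).trans h)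
  have eκ : |κ| ≤ 1 := by rwa [abs_of_nonneg hκ]
  have t1 := abs_le.1 (step (step eκ k1') r2)
  have t2 := abs_le.1 (step (step eκ l1) o2)
  have t3 := abs_le.1 (step l1 r2)
  have t4 := abs_le.1 (step (step eκ o3) l2)
  have t5 := abs_le.1 (step (step eκ k2') r3)
  have t6 := abs_le.1 (step r3 l2)
  have main : (κ * C1 + R1) * (κ * C2 + R2) - (κ * C3 + R3) * (κ * C4 + R4) =
      κ ^ 2 * (C1 * C2 - C3 * C4) + κ * (C1 - C3) * R2 + κ * (R1 - R3) * C2 +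
        (R1 - R3) * R2 + κ * C3 * (R2 - R4) + κ * (C2 - C4) * R3 + R3 * (R2 - R4) := by ring
  rw [main]
  have hk2 : κ ^ 2 * (1 / 2 * (α * y * (α ^ 2 - y ^ 2) * (2 * s))) ≤
      κ ^ 2 * (C1 * C2 - C3 * C4) := by
    gcongr
    exact hgain'.trans hgain
  -- The error terms have total coefficient `π / 400 + 1 / 75 + 1 / 15000 < 0.0213`.
  linarith [t1.1, t2.1, t3.1, t4.1, t5.1, t6.1]

/-- The torque that the density `w ⊗ w` exerts on the square of half-width `α`, rotated by `θ`. -/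
def torque (w : ℝ → ℝ) (α θ : ℝ) : ℝ :=
  4 * ∫ y in -α..α, y * (w (Real.cos θ * α + Real.sin θ * y) *
    w (Real.cos θ * y - Real.sin θ * α))

theorem torque_neg {w : ℝ → ℝ} (hw : ∀ x, w (-x) = w x) (α θ : ℝ) :
    torque w α (-θ) = -torque w α θ := by
  unfold torque
  have := intervalIntegral.integral_comp_neg (a := -α) (b := α) (fun y : ℝ =>
    y * (w (Real.cos (-θ) * α + Real.sin (-θ) * y) * w (Real.cos (-θ) * y - Real.sin (-θ) * α)))
  rw [neg_neg] at this
  rw [← this, ← mul_neg, ← intervalIntegral.integral_neg]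
  congr 1
  refine intervalIntegral.integral_congr fun y _ => ?_
  simp only [Real.cos_neg, Real.sin_neg]
  rw [← hw (Real.cos θ * -y - -Real.sin θ * α)]
  ring_nf

theorem torque_eq {w : ℝ → ℝ} (hw : ∀ x, w (-x) = w x) (hc : Continuous w) (α θ : ℝ) :
    torque w α θ = -(4 * ∫ y in (0 : ℝ)..α,
      y * (w (Real.cos θ * α - Real.sin θ * y) * w (Real.cos θ * y + Real.sin θ * α) -
        w (Real.cos θ * α + Real.sin θ * y) * w (Real.cos θ * y - Real.sin θ * α))) := by
  have hcont : Continuous fun y : ℝ => y * (w (Real.cos θ * α + Real.sin θ * y) *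
    w (Real.cos θ * y - Real.sin θ * α)) := by fun_prop
  have hcont' : Continuous fun y : ℝ => -y * (w (Real.cos θ * α + Real.sin θ * -y) *
    w (Real.cos θ * -y - Real.sin θ * α)) := by fun_prop
  have h1 := intervalIntegral.integral_comp_neg (a := 0) (b := α) (fun y : ℝ =>
    y * (w (Real.cos θ * α + Real.sin θ * y) * w (Real.cos θ * y - Real.sin θ * α)))
  rw [neg_zero] at h1
  rw [torque, ← intervalIntegral.integral_add_adjacent_intervals (b := 0)
    (hcont.intervalIntegrable _ _) (hcont.intervalIntegrable _ _), ← h1,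
    ← intervalIntegral.integral_add (hcont'.intervalIntegrable _ _)
      (hcont.intervalIntegrable _ _), ← mul_neg, ← intervalIntegral.integral_neg]
  congr 1
  refine intervalIntegral.integral_congr fun y _ => ?_
  rw [← hw (Real.cos θ * -y - Real.sin θ * α)]
  ring_nf

/-- The torque restores alignment: it pushes a tilt `θ ∈ [0, π / 7]` back towards `0`, at a linear
rate. -/
theorem torque_le {w ρ : ℝ → ℝ} {α θ κ m : ℝ} (hα : α ^ 2 = 1 / 2) (hα0 : 0 < α)
    (hθ : 0 ≤ θ) (hθ' : θ ≤ Real.pi / 7) (hκ : 0.995 ≤ κ) (hκ1 : κ ≤ 1) (hm : 1 ≤ m ^ 2)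
    (hw : ∀ x, w (-x) = w x) (hc : Continuous w)
    (hwρ : ∀ x, w x = m * (κ * Real.cos (Real.pi / 2 * x) + ρ x))
    (hb : ∀ x, |x| ≤ 19 / 20 → |ρ x| ≤ 1 / 200)
    (hL : ∀ x x', |x| ≤ 19 / 20 → |x'| ≤ 19 / 20 → |ρ x - ρ x'| ≤ 1 / 75 * |x - x'|) :
    torque w α θ ≤ -(1 / 200 * θ) := by
  have hα1 : α ≤ 0.7072 := by nlinarith
  have hs : 0 ≤ Real.sin θ := Real.sin_nonneg_of_nonneg_of_le_pi hθ (by linarith [Real.pi_pos])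
  have hs1 : 0.63 * θ ≤ Real.sin θ := by
    refine le_trans ?_ (Real.mul_le_sin hθ (by linarith [Real.pi_pos]))
    gcongr
    rw [le_div_iff₀ Real.pi_pos]
    linarith [Real.pi_lt_d2]
  have hint : ∫ y in (0 : ℝ)..α, m ^ 2 * (κ ^ 2 * α * Real.sin θ * (α ^ 2 * y ^ 2 - y ^ 4) -
      0.0426 * Real.sin θ * (y ^ 2 + α * y)) =
      m ^ 2 * (κ ^ 2 * α * Real.sin θ * (α ^ 2 * (α ^ 3 / 3) - α ^ 5 / 5) -
        0.0426 * Real.sin θ * (α ^ 3 / 3 + α * (α ^ 2 / 2))) := by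
    rw [intervalIntegral.integral_eq_sub_of_hasDerivAt (f := fun y => m ^ 2 * (κ ^ 2 * α *
      Real.sin θ * (α ^ 2 * (y ^ 3 / 3) - y ^ 5 / 5) -
        0.0426 * Real.sin θ * (y ^ 3 / 3 + α * (y ^ 2 / 2))))]
    · simp
    · intro y _
      have := (((((hasDerivAt_pow 3 y).div_const 3).const_mul (α ^ 2)).sub
        ((hasDerivAt_pow 5 y).div_const 5)).const_mul (κ ^ 2 * α * Real.sin θ)).sub
        ((((hasDerivAt_pow 3 y).div_const 3).add
          (((hasDerivAt_pow 2 y).div_const 2).const_mul α)).const_mul (0.0426 * Real.sin θ))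
      refine (this.const_mul (m ^ 2)).congr_deriv ?_
      push_cast
      ring
    · exact Continuous.intervalIntegrable (by fun_prop) _ _
  have hmono : ∫ y in (0 : ℝ)..α, m ^ 2 * (κ ^ 2 * α * Real.sin θ * (α ^ 2 * y ^ 2 - y ^ 4) -
      0.0426 * Real.sin θ * (y ^ 2 + α * y)) ≤ ∫ y in (0 : ℝ)..α,
      y * (w (Real.cos θ * α - Real.sin θ * y) * w (Real.cos θ * y + Real.sin θ * α) -
        w (Real.cos θ * α + Real.sin θ * y) * w (Real.cos θ * y - Real.sin θ * α)) := by
    refine intervalIntegral.integral_mono_on hα0.le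
      (Continuous.intervalIntegrable (by fun_prop) _ _)
      (Continuous.intervalIntegrable (by fun_prop) _ _) fun y hy => ?_
    have h := edge_gain (ρ := ρ) hα hα0 hy.1 hy.2 hθ hθ' (by linarith : 0 ≤ κ) hκ1 hb hL
    have h2 : 0 ≤ m ^ 2 * y := mul_nonneg (sq_nonneg _) hy.1
    have h3 := mul_le_mul_of_nonneg_left h h2
    rw [hwρ, hwρ, hwρ, hwρ]
    refine le_trans (le_of_eq ?_) (h3.trans (le_of_eq ?_)) <;> ring
  rw [hint] at hmono
  rw [torque_eq hw hc]
  have e3 : α ^ 3 = α / 2 := by rw [pow_succ, hα]; ring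
  have e5 : α ^ 5 = α / 4 := by rw [show α ^ 5 = (α ^ 2) ^ 2 * α by ring, hα]; ring
  have e : κ ^ 2 * α * Real.sin θ * (α ^ 2 * (α ^ 3 / 3) - α ^ 5 / 5) -
      0.0426 * Real.sin θ * (α ^ 3 / 3 + α * (α ^ 2 / 2)) =
      Real.sin θ * (κ ^ 2 / 60 - 0.01775 * α) := by
    rw [e3, e5, hα]
    linear_combination (κ ^ 2 * Real.sin θ / 30) * hα
  rw [e] at hmono
  have hk2 : 0.99 ≤ κ ^ 2 := by nlinarith
  have h1 : 0.0036 * Real.sin θ ≤ Real.sin θ * (κ ^ 2 / 60 - 0.01775 * α) := by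
    rw [mul_comm]
    gcongr
    linarith
  have h2 : 0 ≤ Real.sin θ * (κ ^ 2 / 60 - 0.01775 * α) := le_trans (by positivity) h1
  have h3 : Real.sin θ * (κ ^ 2 / 60 - 0.01775 * α) ≤
      m ^ 2 * (Real.sin θ * (κ ^ 2 / 60 - 0.01775 * α)) := le_mul_of_one_le_left h2 hm
  linarith

theorem abs_torque_le {w : ℝ → ℝ} {α θ B L : ℝ} (hα : α ^ 2 = 1 / 2) (hα0 : 0 < α)
    (hθ : 0 ≤ θ) (hθ' : θ ≤ Real.pi / 7)
    (hw : ∀ x, w (-x) = w x) (hb : ∀ x, |w x| ≤ B) (hL : ∀ x y, |w x - w y| ≤ L * |x - y|)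
    (hL0 : 0 ≤ L) :
    |torque w α θ| ≤ 16 * B * L * θ := by
  have hα1 : α ≤ 1 := by nlinarith
  have hB : 0 ≤ B := (abs_nonneg _).trans (hb 0)
  have hs : 0 ≤ Real.sin θ := Real.sin_nonneg_of_nonneg_of_le_pi hθ (by linarith [Real.pi_pos])
  rw [torque_eq hw (continuous_of_abs_sub_le hL), abs_neg, abs_mul, abs_of_pos (by norm_num)]
  have h := intervalIntegral.norm_integral_le_of_norm_le_const (a := 0) (b := α)
    (C := 4 * B * L * θ) (f := fun y : ℝ =>
      y * (w (Real.cos θ * α - Real.sin θ * y) * w (Real.cos θ * y + Real.sin θ * α) -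
        w (Real.cos θ * α + Real.sin θ * y) * w (Real.cos θ * y - Real.sin θ * α))) (by
      intro y hy
      rw [Set.uIoc_of_le hα0.le] at hy
      have hy0 : 0 ≤ y := hy.1.le
      have hy1 : y ≤ 1 := hy.2.trans hα1
      have l1 := hL (Real.cos θ * α - Real.sin θ * y) (Real.cos θ * α + Real.sin θ * y)
      have l2 := hL (Real.cos θ * y + Real.sin θ * α) (Real.cos θ * y - Real.sin θ * α)
      rw [show Real.cos θ * α - Real.sin θ * y - (Real.cos θ * α + Real.sin θ * y) =
        -(2 * (Real.sin θ * y)) by ring, abs_neg,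
        abs_of_nonneg (show 0 ≤ 2 * (Real.sin θ * y) by positivity)] at l1
      rw [show Real.cos θ * y + Real.sin θ * α - (Real.cos θ * y - Real.sin θ * α) =
        2 * (Real.sin θ * α) by ring,
        abs_of_nonneg (show 0 ≤ 2 * (Real.sin θ * α) by positivity)] at l2
      have sθ := Real.sin_le hθ
      have m1 : Real.sin θ * y ≤ θ := (mul_le_of_le_one_right hs hy1).trans sθ
      have m2 : Real.sin θ * α ≤ θ := (mul_le_of_le_one_right hs hα1).trans sθ
      replace l1 := l1.trans (by gcongr : L * (2 * (Real.sin θ * y)) ≤ L * (2 * θ))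
      replace l2 := l2.trans (by gcongr : L * (2 * (Real.sin θ * α)) ≤ L * (2 * θ))
      have b1 := hb (Real.cos θ * y + Real.sin θ * α)
      have b2 := hb (Real.cos θ * α + Real.sin θ * y)
      generalize w (Real.cos θ * α - Real.sin θ * y) = w1 at *
      generalize w (Real.cos θ * y + Real.sin θ * α) = w2 at *
      generalize w (Real.cos θ * α + Real.sin θ * y) = w3 at *
      generalize w (Real.cos θ * y - Real.sin θ * α) = w4 at *
      rw [Real.norm_eq_abs, abs_mul, abs_of_nonneg hy0]
      calc y * |w1 * w2 - w3 * w4| ≤ 1 * |w1 * w2 - w3 * w4| := by gcongr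
        _ = |(w1 - w3) * w2 + w3 * (w2 - w4)| := by rw [one_mul]; congr 1; ring
        _ ≤ |w1 - w3| * |w2| + |w3| * |w2 - w4| := by
            rw [← abs_mul, ← abs_mul]; exact abs_add_le _ _
        _ ≤ L * (2 * θ) * B + B * (L * (2 * θ)) := by gcongr
        _ = _ := by ring)
  rw [Real.norm_eq_abs, sub_zero, abs_of_pos hα0] at h
  calc _ ≤ 4 * (4 * B * L * θ * α) := by gcongr
    _ ≤ 4 * (4 * B * L * θ * 1) := by gcongr
    _ = _ := by ring

/-! ### The smoothed profile -/

section Profile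

variable {m : ℝ} {e : ℝ → ℝ}

theorem profile_neg (he : IsProfile m e) (x : ℝ) : profile m e (-x) = profile m e x := by
  rw [profile, profile, cosBump_neg, he.even]

theorem IsProfile.le_three_halves (he : IsProfile m e) : m ≤ 1.5 := by
  nlinarith [he.pos, he.le_two]

theorem abs_profile_le (he : IsProfile m e) (x : ℝ) : |profile m e x| ≤ 2 := by
  rw [profile, abs_mul, abs_of_pos he.pos]
  calc m * |cosBump x + e x| ≤ 1.5 * (1 + 1 / 2000) := by
        gcongr
        · exact he.le_three_halves
        · exact (abs_add_le _ _).trans (add_le_add (abs_cosBump_le x) (he.bound x))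
    _ ≤ 2 := by norm_num

theorem abs_profile_sub_le (he : IsProfile m e) (x y : ℝ) :
    |profile m e x - profile m e y| ≤ 3 * |x - y| := by
  have h1 := abs_cosBump_sub_le x y
  have h2 := he.lipschitz x y
  rw [profile, profile, ← mul_sub, abs_mul, abs_of_pos he.pos]
  calc m * |cosBump x + e x - (cosBump y + e y)|
      = m * |(cosBump x - cosBump y) + (e x - e y)| := by ring_nf
    _ ≤ 1.5 * (Real.pi / 2 * |x - y| + 1 / 2000 * |x - y|) := by
        gcongr
        · exact he.le_three_halves
        · exact (abs_add_le _ _).trans (add_le_add h1 h2)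
    _ ≤ 3 * |x - y| := by nlinarith [Real.pi_lt_d2, abs_nonneg (x - y)]

theorem profile_eq_zero (he : IsProfile m e) {x : ℝ} (hx : 1 < |x|) : profile m e x = 0 := by
  rw [profile, cosBump_eq_zero hx, he.support x hx, add_zero, mul_zero]

theorem torque_smooth_profile_le (he : IsProfile m e) {v : NNReal} (hv : (v : ℝ) ≤ 2 / 10 ^ 4)
    {α θ : ℝ} (hα : α ^ 2 = 1 / 2) (hα0 : 0 < α) (hθ : 0 ≤ θ) (hθ' : θ ≤ Real.pi / 7) :
    torque (smooth v (profile m e)) α θ ≤ -(1 / 200 * θ) := by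
  refine torque_le (ρ := smoothError v e) hα hα0 hθ hθ' ?_ ?_ he.one_le
    (smooth_neg (profile_neg he))
    (continuous_of_abs_sub_le (abs_smooth_sub_le (abs_profile_sub_le he) (abs_profile_le he)))
    (smooth_profile he v) (fun x hx => abs_smoothError_le he hv hx)
    (fun x y hx hy => abs_smoothError_sub_le he hv hx hy)
  · have h := Real.add_one_le_exp (-((v : ℝ) * (Real.pi / 2) ^ 2 / 2))
    refine le_trans ?_ h
    have h1 : (Real.pi / 2) ^ 2 ≤ 4 := by nlinarith [Real.pi_pos, Real.pi_lt_d2]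
    have h2 : (v : ℝ) * (Real.pi / 2) ^ 2 ≤ 2 / 10 ^ 4 * 4 := by gcongr
    linarith
  · rw [Real.exp_le_one_iff]
    have : (0 : ℝ) ≤ v := v.2
    have : 0 ≤ (v : ℝ) * (Real.pi / 2) ^ 2 / 2 := by positivity
    linarith

theorem abs_torque_smooth_profile_le (he : IsProfile m e) (v : NNReal)
    {α θ : ℝ} (hα : α ^ 2 = 1 / 2) (hα0 : 0 < α) (hθ : 0 ≤ θ) (hθ' : θ ≤ Real.pi / 7) :
    |torque (smooth v (profile m e)) α θ| ≤ 96 * θ := by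
  have h := abs_torque_le hα hα0 hθ hθ' (smooth_neg (v := v) (profile_neg he))
    (abs_smooth_le (abs_profile_le he))
    (abs_smooth_sub_le (abs_profile_sub_le he) (abs_profile_le he)) (by norm_num)
  linarith

/-- One step of gradient descent contracts the tilt angle. -/
theorem abs_add_mul_torque_le (he : IsProfile m e) {v : NNReal} (hv : (v : ℝ) ≤ 2 / 10 ^ 4)
    {α θ β : ℝ} (hα : α ^ 2 = 1 / 2) (hα0 : 0 < α) (hβ : 0 < β) (hβ1 : β ≤ 1 / 100)
    (hθ : |θ| ≤ Real.pi / 7) :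
    |θ + β * torque (smooth v (profile m e)) α θ| ≤ (1 - β / 200) * |θ| := by
  have key : ∀ θ, 0 ≤ θ → θ ≤ Real.pi / 7 →
      |θ + β * torque (smooth v (profile m e)) α θ| ≤ (1 - β / 200) * θ := by
    intro θ h0 h1
    have k1 := torque_smooth_profile_le he hv hα hα0 h0 h1
    have k2 := (abs_le.1 (abs_torque_smooth_profile_le he v hα hα0 h0 h1)).1
    have k3 : β * -(96 * θ) ≤ β * torque (smooth v (profile m e)) α θ := by gcongr
    have k4 : β * torque (smooth v (profile m e)) α θ ≤ β * -(1 / 200 * θ) := by gcongr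
    have k5 : β * θ ≤ 1 / 100 * θ := by gcongr
    rw [abs_of_nonneg (by linarith)]
    linarith
  rcases le_total 0 θ with h | h
  · rw [abs_of_nonneg h] at hθ ⊢
    exact key θ h hθ
  · rw [abs_of_nonpos h] at hθ ⊢
    have := key (-θ) (by linarith) hθ
    rw [torque_neg (smooth_neg (profile_neg he)), mul_neg, ← neg_add, abs_neg] at this
    exact this

end Profile

/-! ### Differentiating the mass of a rotated square -/

theorem intervalIntegrable_of_abs_le {f : ℝ → ℝ} (hf : Measurable f) {B : ℝ}
    (hB : ∀ x, |f x| ≤ B) (a b : ℝ) : IntervalIntegrable f volume a b := by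
  rw [intervalIntegrable_iff, Set.uIoc]
  exact Integrable.of_bound hf.aestronglyMeasurable B (.of_forall hB)

theorem integral_restrict_Icc_eq {α : ℝ} (hα : 0 ≤ α) (f : ℝ → ℝ) :
    ∫ x, f x ∂(volume.restrict (Set.Icc (-α) α)) = ∫ x in -α..α, f x := by
  rw [intervalIntegral.integral_of_le (by linarith), integral_Icc_eq_integral_Ioc]

/-- The angular derivative of the integral of `w ⊗ w` over a rotated square is the torque: the
angular vector field is divergence free, so only the edges contribute, and the four edges
contribute equally because `w` is even. -/
theorem hasDerivAt_integral_rotated {w w' : ℝ → ℝ} {α B L : ℝ} (hα : 0 ≤ α)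
    (hd : ∀ x, HasDerivAt w (w' x) x) (hm : Measurable w') (hb : ∀ x, |w x| ≤ B)
    (hL : ∀ x, |w' x| ≤ L) (hw : ∀ x, w (-x) = w x) (θ : ℝ) :
    HasDerivAt (fun θ => ∫ q, w (Real.cos θ * q.1 + Real.sin θ * q.2) *
        w (Real.cos θ * q.2 - Real.sin θ * q.1)
        ∂((volume.restrict (Set.Icc (-α) α)).prod (volume.restrict (Set.Icc (-α) α))))
      (torque w α θ) θ := by
  have hc : Continuous w := continuous_iff_continuousAt.2 fun x => (hd x).continuousAt
  have hB : 0 ≤ B := (abs_nonneg _).trans (hb 0)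
  have hL0 : 0 ≤ L := (abs_nonneg _).trans (hL 0)
  set μ := volume.restrict (Set.Icc (-α) α) with hμ
  have hQ : ∀ᵐ q ∂μ.prod μ, |q.1| ≤ α ∧ |q.2| ≤ α := by
    rw [hμ, Measure.prod_restrict]
    filter_upwards [ae_restrict_mem (measurableSet_Icc.prod measurableSet_Icc)] with q hq
    exact ⟨abs_le.2 hq.1, abs_le.2 hq.2⟩
  have hlin : ∀ (θ : ℝ) {a b : ℝ}, |a| ≤ α → |b| ≤ α →
      |Real.cos θ * a - Real.sin θ * b| ≤ 2 * α ∧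
      |Real.cos θ * a + Real.sin θ * b| ≤ 2 * α := by
    intro θ a b ha hb
    have h1 : |Real.cos θ * a| ≤ 1 * α := by
      rw [abs_mul]; gcongr; exact Real.abs_cos_le_one θ
    have h2 : |Real.sin θ * b| ≤ 1 * α := by
      rw [abs_mul]; gcongr; exact Real.abs_sin_le_one θ
    exact ⟨(abs_sub _ _).trans (by linarith), (abs_add_le _ _).trans (by linarith)⟩
  -- Differentiation under the integral sign; a constant dominates, as the square is bounded.
  have h1 := hasDerivAt_integral_of_dominated_loc_of_deriv_le (μ := μ.prod μ) (x₀ := θ)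
    (s := Set.univ)
    (F := fun θ q => w (Real.cos θ * q.1 + Real.sin θ * q.2) *
        w (Real.cos θ * q.2 - Real.sin θ * q.1))
    (F' := fun θ q => w' (Real.cos θ * q.1 + Real.sin θ * q.2) *
          (Real.cos θ * q.2 - Real.sin θ * q.1) * w (Real.cos θ * q.2 - Real.sin θ * q.1) -
        w (Real.cos θ * q.1 + Real.sin θ * q.2) * (w' (Real.cos θ * q.2 - Real.sin θ * q.1) *
          (Real.cos θ * q.1 + Real.sin θ * q.2)))
    (bound := fun _ => L * (2 * α) * B + B * (L * (2 * α)))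
    Filter.univ_mem
    (.of_forall fun θ => by
      refine Continuous.aestronglyMeasurable ?_
      fun_prop)
    (by
      refine Integrable.of_bound (C := B * B) (Continuous.aestronglyMeasurable (by fun_prop))
        (.of_forall fun q => ?_)
      rw [norm_mul]
      exact mul_le_mul (hb _) (hb _) (abs_nonneg _) hB)
    (Measurable.aestronglyMeasurable (by fun_prop))
    (by
      filter_upwards [hQ] with q hq θ _
      refine (norm_sub_le _ _).trans ?_
      rw [norm_mul, norm_mul, norm_mul, norm_mul]
      gcongr
      · exact hL _
      · exact (hlin θ hq.2 hq.1).1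
      · exact hb _
      · exact hb _
      · exact hL _
      · exact (hlin θ hq.1 hq.2).2)
    (integrable_const _)
    (.of_forall fun q θ _ => by
      have e1 : HasDerivAt (fun θ => Real.cos θ * q.1 + Real.sin θ * q.2)
          (Real.cos θ * q.2 - Real.sin θ * q.1) θ :=
        (((Real.hasDerivAt_cos θ).mul_const q.1).add
          ((Real.hasDerivAt_sin θ).mul_const q.2)).congr_deriv (by ring)
      have e2 : HasDerivAt (fun θ => Real.cos θ * q.2 - Real.sin θ * q.1)
          (-(Real.cos θ * q.1 + Real.sin θ * q.2)) θ :=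
        (((Real.hasDerivAt_cos θ).mul_const q.2).sub
          ((Real.hasDerivAt_sin θ).mul_const q.1)).congr_deriv (by ring)
      exact (((hd _).comp θ e1).mul ((hd _).comp θ e2)).congr_deriv (by
        simp only [Function.comp_apply]; ring))
  refine h1.2.congr_deriv ?_
  clear h1
  set c := Real.cos θ with hcdef
  set s := Real.sin θ with hsdef
  have hcle : |c| ≤ 1 := Real.abs_cos_le_one θ
  have hsle : |s| ≤ 1 := Real.abs_sin_le_one θ
  -- The partial derivatives of the rotated density.
  set Dx : ℝ → ℝ → ℝ := fun x y => w' (c * x + s * y) * c * w (c * y - s * x) +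
    w (c * x + s * y) * (w' (c * y - s * x) * -s) with hDx
  set Dy : ℝ → ℝ → ℝ := fun x y => w' (c * x + s * y) * s * w (c * y - s * x) +
    w (c * x + s * y) * (w' (c * y - s * x) * c) with hDy
  have bDx : ∀ x y, |Dx x y| ≤ L * 1 * B + B * (L * 1) := fun x y => by
    refine (abs_add_le _ _).trans ?_
    rw [abs_mul, abs_mul, abs_mul, abs_mul, abs_neg]
    gcongr <;> first | exact hL _ | exact hb _
  have bDy : ∀ x y, |Dy x y| ≤ L * 1 * B + B * (L * 1) := fun x y => by
    refine (abs_add_le _ _).trans ?_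
    rw [abs_mul, abs_mul, abs_mul, abs_mul]
    gcongr <;> first | exact hL _ | exact hb _
  have mDx : Measurable fun q : ℝ × ℝ => Dx q.1 q.2 := by simp only [hDx]; fun_prop
  have mDy : Measurable fun q : ℝ × ℝ => Dy q.1 q.2 := by simp only [hDy]; fun_prop
  have iDx : Integrable (fun q : ℝ × ℝ => q.2 * Dx q.1 q.2) (μ.prod μ) := by
    refine Integrable.of_bound (C := α * (L * 1 * B + B * (L * 1)))
      (measurable_snd.mul mDx).aestronglyMeasurable ?_
    filter_upwards [hQ] with q hq
    rw [norm_mul]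
    gcongr
    · exact hq.2
    · exact bDx _ _
  have iDy : Integrable (fun q : ℝ × ℝ => q.1 * Dy q.1 q.2) (μ.prod μ) := by
    refine Integrable.of_bound (C := α * (L * 1 * B + B * (L * 1)))
      (measurable_fst.mul mDy).aestronglyMeasurable ?_
    filter_upwards [hQ] with q hq
    rw [norm_mul]
    gcongr
    · exact hq.1
    · exact bDy _ _
  have fx : ∀ y, ∫ x, Dx x y ∂μ = w (c * α + s * y) * w (c * y - s * α) -
      w (c * -α + s * y) * w (c * y - s * -α) := by
    intro y
    rw [hμ, integral_restrict_Icc_eq hα]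
    refine intervalIntegral.integral_eq_sub_of_hasDerivAt
      (f := fun x => w (c * x + s * y) * w (c * y - s * x)) (fun x _ => ?_)
      (intervalIntegrable_of_abs_le (mDx.comp measurable_prodMk_right) (fun x => bDx x y) _ _)
    have e1 : HasDerivAt (fun x => c * x + s * y) c x := by
      simpa using ((hasDerivAt_id x).const_mul c).add_const (s * y)
    have e2 : HasDerivAt (fun x => c * y - s * x) (-s) x := by
      simpa using ((hasDerivAt_id x).const_mul s).const_sub (c * y)
    exact ((hd _).comp x e1).mul ((hd _).comp x e2)
  have fy : ∀ x, ∫ y, Dy x y ∂μ = w (c * x + s * α) * w (c * α - s * x) -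
      w (c * x + s * -α) * w (c * -α - s * x) := by
    intro x
    rw [hμ, integral_restrict_Icc_eq hα]
    refine intervalIntegral.integral_eq_sub_of_hasDerivAt
      (f := fun y => w (c * x + s * y) * w (c * y - s * x)) (fun y _ => ?_)
      (intervalIntegrable_of_abs_le (mDy.comp measurable_prodMk_left) (fun y => bDy x y) _ _)
    have e1 : HasDerivAt (fun y => c * x + s * y) s y := by
      simpa using ((hasDerivAt_id y).const_mul s).const_add (c * x)
    have e2 : HasDerivAt (fun y => c * y - s * x) c y := by
      simpa using ((hasDerivAt_id y).const_mul c).sub_const (s * x)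
    exact ((hd _).comp y e1).mul ((hd _).comp y e2)
  have split : ∀ q : ℝ × ℝ, w' (c * q.1 + s * q.2) * (c * q.2 - s * q.1) * w (c * q.2 - s * q.1) -
      w (c * q.1 + s * q.2) * (w' (c * q.2 - s * q.1) * (c * q.1 + s * q.2)) =
      q.2 * Dx q.1 q.2 - q.1 * Dy q.1 q.2 := by
    intro q; simp only [hDx, hDy]; ring
  simp only [split]
  rw [integral_sub iDx iDy, integral_prod_symm _ iDx, integral_prod _ iDy]
  simp only [integral_const_mul, fx, fy]
  rw [hμ, integral_restrict_Icc_eq hα, integral_restrict_Icc_eq hα]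
  -- The four edges contribute equally.
  have ii : ∀ {f : ℝ → ℝ}, Continuous f → IntervalIntegrable f volume (-α) α :=
    fun hf => hf.intervalIntegrable _ _
  have flip : ∀ f : ℝ → ℝ, ∫ y in -α..α, f (-y) = ∫ y in -α..α, f y := by
    intro f
    have := intervalIntegral.integral_comp_neg (a := -α) (b := α) f
    rwa [neg_neg] at this
  set T := ∫ y in -α..α, y * (w (c * α + s * y) * w (c * y - s * α)) with hT
  have t2 : ∫ y in -α..α, y * (w (c * -α + s * y) * w (c * y - s * -α)) = -T := by
    rw [← flip, hT, ← intervalIntegral.integral_neg]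
    refine intervalIntegral.integral_congr fun y _ => ?_
    rw [← hw (c * -α + s * -y), ← hw (c * -y - s * -α)]
    ring_nf
  have t3 : ∫ x in -α..α, x * (w (c * x + s * α) * w (c * α - s * x)) = -T := by
    rw [← flip, hT, ← intervalIntegral.integral_neg]
    refine intervalIntegral.integral_congr fun y _ => ?_
    rw [← hw (c * -y + s * α)]
    ring_nf
  have t4 : ∫ x in -α..α, x * (w (c * x + s * -α) * w (c * -α - s * x)) = T := by
    rw [hT]
    refine intervalIntegral.integral_congr fun y _ => ?_
    rw [← hw (c * -α - s * y)]
    ring_nf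
  simp only [mul_sub]
  rw [intervalIntegral.integral_sub (ii (by fun_prop)) (ii (by fun_prop)),
    intervalIntegral.integral_sub (ii (by fun_prop)) (ii (by fun_prop)), t2, t3, t4,
    torque]
  ring

/-! ### Rotations of the plane -/

theorem rot_neg_rot (θ : ℝ) (p : ℝ × ℝ) : rot (-θ) (rot θ p) = p := by
  have h := Real.sin_sq_add_cos_sq θ
  ext
  · simp only [rot, Real.cos_neg, Real.sin_neg]; linear_combination p.1 * h
  · simp only [rot, Real.cos_neg, Real.sin_neg]; linear_combination p.2 * h

theorem measurable_rot (θ : ℝ) : Measurable (rot θ) := by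
  unfold rot
  fun_prop

/-- The rotation `rot θ` as a measurable equivalence. -/
def rotEquiv (θ : ℝ) : ℝ × ℝ ≃ᵐ ℝ × ℝ where
  toFun := rot θ
  invFun := rot (-θ)
  left_inv := rot_neg_rot θ
  right_inv p := by simpa using rot_neg_rot (-θ) p
  measurable_toFun := measurable_rot θ
  measurable_invFun := measurable_rot (-θ)

theorem measurePreserving_rotEquiv (θ : ℝ) : MeasurePreserving (rotEquiv θ) volume volume := by
  have h := (Complex.volume_preserving_equiv_real_prod.comp
    (rotation (Circle.exp θ)).measurePreserving).comp
    (Complex.volume_preserving_equiv_real_prod.symm Complex.measurableEquivRealProd)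
  suffices hfun : ⇑(rotEquiv θ) = (⇑Complex.measurableEquivRealProd ∘ ⇑(rotation (Circle.exp θ))) ∘
      ⇑Complex.measurableEquivRealProd.symm by
    refine ⟨(rotEquiv θ).measurable, ?_⟩
    rw [hfun]
    exact h.map_eq
  funext p
  change rot θ p = Complex.measurableEquivRealProd
    (rotation (Circle.exp θ) (Complex.measurableEquivRealProd.symm p))
  rw [rotation_apply, Circle.coe_exp, Complex.exp_mul_I]
  have hp : Complex.measurableEquivRealProd.symm p = (p.1 : ℂ) + p.2 * Complex.I := by
    apply Complex.measurableEquivRealProd.injective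
    rw [MeasurableEquiv.apply_symm_apply]
    ext <;> simp [Complex.measurableEquivRealProd_apply]
  rw [hp, Complex.measurableEquivRealProd_apply]
  ext
  · simp [rot, Complex.cos_ofReal_re, Complex.sin_ofReal_re]
  · simp [rot, Complex.cos_ofReal_re, Complex.sin_ofReal_re]
    ring

/-- The square is invariant under quarter turns. -/
theorem rotTemplate_periodic (α : ℝ) : Function.Periodic (rotTemplate α) (Real.pi / 2) := by
  intro θ
  funext p
  simp only [rotTemplate, template, rot, Set.indicator, Set.mem_ofPred_eq, Real.cos_add_pi_div_two,
    Real.sin_add_pi_div_two]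
  congr 1
  rw [show -Real.sin θ * p.1 - Real.cos θ * p.2 = -(Real.sin θ * p.1 + Real.cos θ * p.2) by ring,
    show Real.cos θ * p.1 + -Real.sin θ * p.2 = Real.cos θ * p.1 - Real.sin θ * p.2 by ring,
    abs_neg, and_comm]

/-! ### The alignment loss as a function of the angle -/

theorem gaussianFilter_eq (σ : ℝ) (p : ℝ × ℝ) :
    gaussianFilter σ p = gaussianPDFReal 0 (Real.toNNReal (σ ^ 2)) p.1 *
      gaussianPDFReal 0 (Real.toNNReal (σ ^ 2)) p.2 := by
  have h0 : 0 ≤ 2 * Real.pi * σ ^ 2 := by positivity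
  rw [gaussianFilter, gaussianPDFReal, gaussianPDFReal, Real.coe_toNNReal _ (sq_nonneg σ),
    show ∀ a b c : ℝ, a * b * (a * c) = (a * a) * (b * c) by intros; ring, ← Real.exp_add,
    ← mul_inv, Real.mul_self_sqrt h0]
  congr 2
  ring

theorem integrable_gaussianFilter (σ : ℝ) : Integrable (gaussianFilter σ) volume := by
  have h := (integrable_gaussianPDFReal 0 (Real.toNNReal (σ ^ 2))).mul_prod
    (integrable_gaussianPDFReal 0 (Real.toNNReal (σ ^ 2)))
  exact h.congr (.of_forall fun p => (gaussianFilter_eq σ p).symm)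

theorem integral_gaussianFilter_mul {σ : ℝ} (hσ : 0 < σ) (f g : ℝ → ℝ) :
    ∫ t, gaussianFilter σ t * (f t.1 * g t.2) =
      (∫ a, f a ∂gaussianReal 0 (Real.toNNReal (σ ^ 2))) *
        ∫ a, g a ∂gaussianReal 0 (Real.toNNReal (σ ^ 2)) := by
  have hv : Real.toNNReal (σ ^ 2) ≠ 0 := by
    rw [Ne, Real.toNNReal_eq_zero, not_le]; positivity
  rw [integral_gaussianReal_eq_integral_smul hv, integral_gaussianReal_eq_integral_smul hv,
    ← integral_prod_mul, ← Measure.volume_eq_prod]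
  refine integral_congr_ae (.of_forall fun t => ?_)
  simp only [gaussianFilter_eq, smul_eq_mul]
  ring

theorem gaussianFilter_rot (σ θ : ℝ) (p : ℝ × ℝ) :
    gaussianFilter σ (rot θ p) = gaussianFilter σ p := by
  unfold gaussianFilter rot
  congr 3
  have h := Real.sin_sq_add_cos_sq θ
  simp only
  linear_combination (-(p.1 ^ 2 + p.2 ^ 2)) * h

/-- The filtered image `φ_{σ²} ∗ f`. -/
abbrev filtered (σ : ℝ) (f : ℝ × ℝ → ℝ) : ℝ × ℝ → ℝ :=
  gaussianFilter σ ⋆[ContinuousLinearMap.lsmul ℝ ℝ, volume] f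

theorem filtered_apply (σ : ℝ) (f : ℝ × ℝ → ℝ) (x : ℝ × ℝ) :
    filtered σ f x = ∫ t, gaussianFilter σ t * f (x - t) := rfl

theorem integrable_filtered {σ : ℝ} {f : ℝ × ℝ → ℝ} (hf : Integrable f volume) :
    Integrable (filtered σ f) volume :=
  (integrable_gaussianFilter σ).integrable_convolution _ hf

theorem integrable_filter_mul_comp {σ : ℝ} {f : ℝ × ℝ → ℝ} (hm : Measurable f) {B : ℝ}
    (hB : ∀ x, |f x| ≤ B) {T : ℝ × ℝ → ℝ × ℝ} (hT : Measurable T) :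
    Integrable (fun t => gaussianFilter σ t * f (T t)) volume :=
  (integrable_gaussianFilter σ).mul_bdd (hm.comp hT).aestronglyMeasurable
    (.of_forall fun t => hB (T t))

theorem abs_filtered_le {σ : ℝ} {f : ℝ × ℝ → ℝ} {B : ℝ} (hB : ∀ x, |f x| ≤ B) (x : ℝ × ℝ) :
    |filtered σ f x| ≤ ∫ t, |gaussianFilter σ t| * B := by
  rw [filtered_apply]
  refine norm_integral_le_of_norm_le (f := fun t => gaussianFilter σ t * f (x - t))
    ((integrable_gaussianFilter σ).abs.mul_const B) (.of_forall fun t => ?_)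
  rw [norm_mul]
  exact mul_le_mul_of_nonneg_left (hB _) (abs_nonneg _)

theorem integral_comp_rot (θ : ℝ) (g : ℝ × ℝ → ℝ) : ∫ x, g (rot θ x) = ∫ x, g x :=
  (measurePreserving_rotEquiv θ).integral_comp' g

theorem rot_sub (θ : ℝ) (p q : ℝ × ℝ) : rot θ (p - q) = rot θ p - rot θ q := by
  ext <;> simp only [rot, Prod.fst_sub, Prod.snd_sub] <;> ring

theorem filtered_comp_rot (σ θ : ℝ) (f : ℝ × ℝ → ℝ) (x : ℝ × ℝ) :
    filtered σ (fun p => f (rot θ p)) x = filtered σ f (rot θ x) := by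
  rw [filtered_apply, filtered_apply,
    ← integral_comp_rot θ fun t => gaussianFilter σ t * f (rot θ x - t)]
  simp only [gaussianFilter_rot, rot_sub]

theorem filtered_tensor {σ : ℝ} (hσ : 0 < σ) (f : ℝ → ℝ) (x : ℝ × ℝ) :
    filtered σ (fun p => f p.1 * f p.2) x =
      smooth (Real.toNNReal (σ ^ 2)) f x.1 * smooth (Real.toNNReal (σ ^ 2)) f x.2 := by
  rw [filtered_apply, smooth_eq_integral_sub, smooth_eq_integral_sub,
    ← integral_gaussianFilter_mul hσ]
  rfl

theorem measurableSet_square (α : ℝ) : MeasurableSet {p : ℝ × ℝ | |p.1| ≤ α ∧ |p.2| ≤ α} :=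
  (measurableSet_le measurable_fst.abs measurable_const).inter
    (measurableSet_le measurable_snd.abs measurable_const)

theorem square_eq (α : ℝ) :
    {p : ℝ × ℝ | |p.1| ≤ α ∧ |p.2| ≤ α} = Set.Icc (-α) α ×ˢ Set.Icc (-α) α := by
  ext p
  simp only [Set.mem_ofPred_eq, Set.mem_prod, Set.mem_Icc, abs_le]

theorem measurable_template (α : ℝ) : Measurable (template α) :=
  measurable_const.indicator (measurableSet_square α)

theorem measurable_rotTemplate (α θ : ℝ) : Measurable (rotTemplate α θ) :=
  (measurable_template α).comp (measurable_rot θ)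

theorem abs_template_le (α : ℝ) (p : ℝ × ℝ) : |template α p| ≤ 1 := by
  unfold template Set.indicator
  split_ifs <;> simp

theorem abs_rotTemplate_le (α θ : ℝ) (p : ℝ × ℝ) : |rotTemplate α θ p| ≤ 1 :=
  abs_template_le α _

theorem integrable_template (α : ℝ) : Integrable (template α) volume := by
  refine (integrable_indicator_iff (measurableSet_square α)).2 ?_
  refine integrableOn_const ?_
  rw [square_eq, Measure.volume_eq_prod, Measure.prod_prod]
  exact (ENNReal.mul_lt_top measure_Icc_lt_top measure_Icc_lt_top).ne

theorem integrable_rotTemplate (α θ : ℝ) : Integrable (rotTemplate α θ) volume :=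
  (measurePreserving_rotEquiv θ).integrable_comp_of_integrable (integrable_template α)

/-- The adjoint of filtering averages the other factor over forward translates. -/
theorem integral_filtered_mul {σ : ℝ} {f B : ℝ × ℝ → ℝ} (hf : Integrable f volume)
    (hfm : Measurable f) {M : ℝ} (hM : ∀ x, |f x| ≤ M) (hB : Integrable B volume)
    (hBm : Measurable B) {N : ℝ} (hN : ∀ x, |B x| ≤ N) :
    ∫ x, filtered σ f x * B x = ∫ x, f x * ∫ t, gaussianFilter σ t * B (x + t) := by
  have hg := integrable_gaussianFilter σ
  have i1 : Integrable (Function.uncurry fun x t => gaussianFilter σ t * f (x - t) * B x)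
      ((volume : Measure (ℝ × ℝ)).prod volume) := by
    refine ((hB.mul_prod hg).mul_bdd (g := fun z : (ℝ × ℝ) × (ℝ × ℝ) => f (z.1 - z.2))
      (hfm.comp (measurable_fst.sub measurable_snd)).aestronglyMeasurable
      (.of_forall fun z => hM _)).congr (.of_forall fun z => ?_)
    simp only [Function.uncurry]
    ring
  have i2 : Integrable (Function.uncurry fun x t => f x * (gaussianFilter σ t * B (x + t)))
      ((volume : Measure (ℝ × ℝ)).prod volume) := by
    refine ((hf.mul_prod hg).mul_bdd (g := fun z : (ℝ × ℝ) × (ℝ × ℝ) => B (z.1 + z.2))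
      (hBm.comp (measurable_fst.add measurable_snd)).aestronglyMeasurable
      (.of_forall fun z => hN _)).congr (.of_forall fun z => ?_)
    simp only [Function.uncurry]
    ring
  simp only [filtered_apply, ← integral_const_mul, ← integral_mul_const]
  rw [integral_integral_swap i1, integral_integral_swap i2]
  refine integral_congr_ae (.of_forall fun t => ?_)
  simp only
  rw [← integral_add_right_eq_self _ t]
  refine integral_congr_ae (.of_forall fun x => ?_)
  simp only [add_sub_cancel_right]
  ring

/-- Up to a constant, the loss is minus the mass that the smoothed representation `w ⊗ w` puts on
the rotated square. -/
theorem exists_loss_eq {σ : ℝ} (hσ : 0 < σ) (α νStar : ℝ) {u : L2} {f : ℝ → ℝ}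
    (huf : u =ᵐ[volume] f) (hf : Integrable f volume) (hfc : Continuous f) {B : ℝ}
    (hB : ∀ x, |f x| ≤ B) {K : ℝ} (hK : ∀ x y, |f x - f y| ≤ K * |x - y|) :
    ∃ c : ℝ, ∀ ν, loss α νStar σ ν u = c -
      ∫ q, smooth (Real.toNNReal (σ ^ 2) + Real.toNNReal (σ ^ 2)) f
          (Real.cos (ν - νStar) * q.1 + Real.sin (ν - νStar) * q.2) *
        smooth (Real.toNNReal (σ ^ 2) + Real.toNNReal (σ ^ 2)) f
          (Real.cos (ν - νStar) * q.2 - Real.sin (ν - νStar) * q.1)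
        ∂((volume.restrict (Set.Icc (-α) α)).prod (volume.restrict (Set.Icc (-α) α))) := by
  set v := Real.toNNReal (σ ^ 2) with hv
  have hB0 : 0 ≤ B := (abs_nonneg _).trans (hB 0)
  set V : ℝ × ℝ → ℝ := fun p => f p.1 * f p.2 with hV
  have hVi : Integrable V volume := hf.mul_prod hf
  have hVm : Measurable V := Continuous.measurable (by fun_prop)
  have hVB : ∀ x, |V x| ≤ B * B := fun x => by
    rw [hV, abs_mul]
    exact mul_le_mul (hB _) (hB _) (abs_nonneg _) hB0
  have hs : Continuous (smooth v f) := continuous_of_abs_sub_le (abs_smooth_sub_le hK hB)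
  have hY : filtered σ V = fun x => smooth v f x.1 * smooth v f x.2 :=
    funext fun x => filtered_tensor hσ f x
  have hYm : Measurable (filtered σ V) := by
    rw [hY]
    exact Continuous.measurable (by fun_prop)
  have hYi := integrable_filtered (σ := σ) hVi
  have hXi := fun θ => integrable_filtered (σ := σ) (integrable_rotTemplate α θ)
  have hae : (fun p : ℝ × ℝ => u p.1 * u p.2) =ᵐ[volume] V := by
    rw [Measure.volume_eq_prod]
    have q1 := (Measure.quasiMeasurePreserving_fst (μ := (volume : Measure ℝ))
      (ν := (volume : Measure ℝ))).ae_eq huf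
    have q2 := (Measure.quasiMeasurePreserving_snd (μ := (volume : Measure ℝ))
      (ν := (volume : Measure ℝ))).ae_eq huf
    filter_upwards [q1, q2] with p h1 h2
    simp only [Function.comp_apply] at h1 h2
    rw [h1, h2]
  have hdiff : ∀ θ x, filtered σ (fun p => rotTemplate α θ p - u p.1 * u p.2) x =
      filtered σ (rotTemplate α θ) x - filtered σ V x := by
    intro θ x
    rw [filtered_apply, filtered_apply, filtered_apply, ← integral_sub
      (integrable_filter_mul_comp (measurable_rotTemplate α θ) (abs_rotTemplate_le α θ)
        (T := fun t => x - t) (measurable_const.sub measurable_id))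
      (integrable_filter_mul_comp hVm hVB (T := fun t => x - t)
        (measurable_const.sub measurable_id))]
    have h := (Measure.measurePreserving_sub_left (volume : Measure (ℝ × ℝ)) x
      ).quasiMeasurePreserving.ae_eq hae
    refine integral_congr_ae ?_
    filter_upwards [h] with t ht
    simp only [Function.comp_apply] at ht
    rw [ht, mul_sub]
  have sq_int : ∀ {g h : ℝ × ℝ → ℝ} {M : ℝ}, Integrable g volume → Integrable h volume →
      (∀ x, |h x| ≤ M) → Integrable (fun x => g x * h x) volume :=
    fun hg hh hM => hg.mul_bdd hh.aestronglyMeasurable (.of_forall hM)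
  have hXb := fun θ => abs_filtered_le (σ := σ) (abs_rotTemplate_le α θ)
  have hYb := abs_filtered_le (σ := σ) hVB
  refine ⟨1 / 2 * (∫ x, filtered σ (template α) x * filtered σ (template α) x) +
    1 / 2 * ∫ x, filtered σ V x * filtered σ V x, fun ν => ?_⟩
  set θ := ν - νStar with hθ
  have hexp : loss α νStar σ ν u =
      1 / 2 * (∫ x, filtered σ (rotTemplate α θ) x * filtered σ (rotTemplate α θ) x) +
      1 / 2 * (∫ x, filtered σ V x * filtered σ V x) -
      ∫ x, filtered σ (rotTemplate α θ) x * filtered σ V x := by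
    have e : ∀ x, (filtered σ (fun p => rotTemplate α θ p - u p.1 * u p.2) x) ^ 2 =
        (filtered σ (rotTemplate α θ) x * filtered σ (rotTemplate α θ) x +
          filtered σ V x * filtered σ V x) -
        2 * (filtered σ (rotTemplate α θ) x * filtered σ V x) := by
      intro x; rw [hdiff]; ring
    have i1 := sq_int (hXi θ) (hXi θ) (hXb θ)
    have i2 := sq_int hYi hYi hYb
    have i3 := sq_int (hXi θ) hYi hYb
    have i12 : Integrable (fun x => filtered σ (rotTemplate α θ) x *
      filtered σ (rotTemplate α θ) x + filtered σ V x * filtered σ V x) volume := i1.add i2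
    change 1 / 2 * ∫ x, (filtered σ (fun p => rotTemplate α θ p - u p.1 * u p.2) x) ^ 2 = _
    rw [integral_congr_ae (.of_forall e), integral_sub i12 (i3.const_mul 2),
      integral_add i1 i2, integral_const_mul]
    ring
  have hinv : ∫ x, filtered σ (rotTemplate α θ) x * filtered σ (rotTemplate α θ) x =
      ∫ x, filtered σ (template α) x * filtered σ (template α) x := by
    rw [← integral_comp_rot θ fun x => filtered σ (template α) x * filtered σ (template α) x]
    refine integral_congr_ae (.of_forall fun x => ?_)
    have h : filtered σ (rotTemplate α θ) x = _ := filtered_comp_rot σ θ (template α) x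
    simp only [h]
  have hcross : ∫ x, filtered σ (rotTemplate α θ) x * filtered σ V x =
      ∫ x, rotTemplate α θ x * (smooth (v + v) f x.1 * smooth (v + v) f x.2) := by
    rw [integral_filtered_mul (integrable_rotTemplate α θ) (measurable_rotTemplate α θ)
      (abs_rotTemplate_le α θ) hYi hYm hYb]
    refine integral_congr_ae (.of_forall fun x => ?_)
    simp only
    congr 1
    rw [hY, ← smooth_smooth hfc hB, ← smooth_smooth hfc hB, smooth.eq_def v (smooth v f) x.1,
      smooth.eq_def v (smooth v f) x.2,
      ← integral_gaussianFilter_mul hσ]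
    rfl
  rw [hexp, hinv, hcross]
  congr 1
  -- The remaining identity is the change of variables `x ↦ rot θ x` in the cross term.
  rw [Measure.prod_restrict, ← square_eq, ← Measure.volume_eq_prod,
    ← integral_indicator (measurableSet_square α)]
  refine Eq.trans ?_ (integral_comp_rot θ _)
  refine integral_congr_ae (.of_forall fun x => ?_)
  have h1 : Real.cos θ * (rot θ x).1 + Real.sin θ * (rot θ x).2 = x.1 := by
    have h := Real.sin_sq_add_cos_sq θ
    simp only [rot]; linear_combination x.1 * h
  have h2 : Real.cos θ * (rot θ x).2 - Real.sin θ * (rot θ x).1 = x.2 := by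
    have h := Real.sin_sq_add_cos_sq θ
    simp only [rot]; linear_combination x.2 * h
  simp only [rotTemplate, template, Set.indicator, h1, h2]
  split_ifs <;> simp

theorem integrable_profile {m : ℝ} {e : ℝ → ℝ} (he : IsProfile m e) :
    Integrable (profile m e) volume := by
  have hc := continuous_of_abs_sub_le (abs_profile_sub_le he)
  refine hc.integrable_of_hasCompactSupport
    (HasCompactSupport.intro (isCompact_Icc (a := -1) (b := 1)) fun x hx => ?_)
  refine profile_eq_zero he (not_le.1 fun h => hx (abs_le.1 h))

theorem hasDerivAt_loss {σ : ℝ} (hσ : 0 < σ) {α : ℝ} (hα : 0 ≤ α) (νStar : ℝ) {u : L2} {m : ℝ}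
    {e : ℝ → ℝ} (he : IsProfile m e) (hu : u =ᵐ[volume] profile m e) (ν : ℝ) :
    HasDerivAt (fun ν => loss α νStar σ ν u)
      (-torque (smooth (Real.toNNReal (σ ^ 2) + Real.toNNReal (σ ^ 2)) (profile m e)) α
        (ν - νStar)) ν := by
  have hv : Real.toNNReal (σ ^ 2) + Real.toNNReal (σ ^ 2) ≠ 0 := by
    have : 0 < Real.toNNReal (σ ^ 2) := Real.toNNReal_pos.2 (by positivity)
    positivity
  have hL : LipschitzWith 3 (profile m e) := LipschitzWith.of_dist_le_mul fun x y => by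
    simpa [Real.dist_eq] using abs_profile_sub_le he x y
  have hc := hL.continuous
  obtain ⟨c, hcl⟩ := exists_loss_eq hσ α νStar hu (integrable_profile he) hc (abs_profile_le he)
    (abs_profile_sub_le he)
  have hd := differentiable_smooth hv hL (abs_profile_le he)
  have hLs : LipschitzWith 3 (smooth (Real.toNNReal (σ ^ 2) + Real.toNNReal (σ ^ 2))
    (profile m e)) := lipschitzWith_smooth hL (abs_profile_le he)
  have h := hasDerivAt_integral_rotated hα (fun x => (hd x).hasDerivAt) (measurable_deriv _)
    (abs_smooth_le (abs_profile_le he)) (fun x => norm_deriv_le_of_lipschitz hLs)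
    (smooth_neg (profile_neg he)) (ν - νStar)
  have h2 := (h.comp_sub_const ν νStar).const_sub c
  exact h2.congr_of_eventuallyEq (.of_forall hcl)

/-! ### Gradient descent on the angle -/

theorem torque_periodic {w : ℝ → ℝ} (hw : ∀ x, w (-x) = w x) (α : ℝ) :
    Function.Periodic (torque w α) (Real.pi / 2) := by
  intro θ
  unfold torque
  congr 1
  refine intervalIntegral.integral_congr fun y _ => ?_
  simp only [Real.cos_add_pi_div_two, Real.sin_add_pi_div_two]
  rw [← hw (-Real.sin θ * y - Real.cos θ * α)]
  ring_nf

/-- Gradient descent started within `π / 7` of an aligned angle converges to that angle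
geometrically. -/
theorem exists_angleIter_eq {σ β : ℝ} (hσ : 0 < σ) (hσ1 : σ ^ 2 ≤ 1 / 10 ^ 4) (hβ : 0 < β)
    (hβ1 : β ≤ 1 / 100) {α : ℝ} (hα : α ^ 2 = 1 / 2) (hα0 : 0 < α) (νStar : ℝ) {u : L2} {m : ℝ}
    {e : ℝ → ℝ} (he : IsProfile m e) (hu : u =ᵐ[volume] profile m e) (j : ℤ) {θ₀ : ℝ}
    (hθ₀ : |θ₀| ≤ Real.pi / 7) (k : ℕ) :
    ∃ θ, angleIter α νStar σ β u (νStar + j * (Real.pi / 2) + θ₀) k =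
      νStar + j * (Real.pi / 2) + θ ∧ |θ| ≤ (1 - β / 200) ^ k * |θ₀| := by
  have hv : ((Real.toNNReal (σ ^ 2) + Real.toNNReal (σ ^ 2) : NNReal) : ℝ) ≤ 2 / 10 ^ 4 := by
    rw [NNReal.coe_add, Real.coe_toNNReal _ (sq_nonneg σ)]
    linarith
  induction k with
  | zero => exact ⟨θ₀, rfl, by simp⟩
  | succ k ih =>
    obtain ⟨θ, h1, h2⟩ := ih
    have hθ : |θ| ≤ Real.pi / 7 := h2.trans ((mul_le_of_le_one_left (abs_nonneg _)
      (pow_le_one₀ (by linarith) (by linarith))).trans hθ₀)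
    refine ⟨θ + β * torque (smooth (Real.toNNReal (σ ^ 2) + Real.toNNReal (σ ^ 2)) (profile m e))
      α θ, ?_, ?_⟩
    · rw [angleIter, h1, (hasDerivAt_loss hσ hα0.le νStar he hu _).deriv,
        show νStar + j * (Real.pi / 2) + θ - νStar = θ + j * (Real.pi / 2) by ring,
        (torque_periodic (smooth_neg (profile_neg he)) α).int_mul j θ]
      ring
    · refine (abs_add_mul_torque_le he hv hα hα0 hβ hβ1 hθ).trans ?_
      rw [pow_succ', mul_assoc]
      gcongr
      linarith

theorem pow_le_of_iterations {β δ : ℝ} (hβ : 0 < β) (hβ1 : β ≤ 1 / 100) (hδ : 0 < δ) {k : ℕ}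
    (hk : -(200 * Real.log δ) / β ≤ k) : (1 - β / 200) ^ k ≤ δ := by
  have h1 : 1 - β / 200 ≤ Real.exp (-(β / 200)) := by
    linarith [Real.add_one_le_exp (-(β / 200))]
  calc (1 - β / 200) ^ k ≤ Real.exp (-(β / 200)) ^ k := pow_le_pow_left₀ (by linarith) h1 k
    _ = Real.exp (k * -(β / 200)) := by rw [← Real.exp_nat_mul]
    _ ≤ Real.exp (Real.log δ) := by
        rw [Real.exp_le_exp]
        rw [div_le_iff₀ hβ] at hk
        linarith
    _ = δ := Real.exp_log hδ

/-- The distance of `x` to the multiples of `p`, written with `realMod`, is at most the distance to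
any one of them. -/
theorem min_realMod_abs_le {x p θ : ℝ} (hp : 0 < p) (j : ℤ) (hx : x = j * p + θ) :
    min (realMod |x| p) (p - realMod |x| p) ≤ |θ| := by
  have key : ∀ (y : ℝ) (i : ℤ) (η : ℝ), y = i * p + η →
      min (realMod y p) (p - realMod y p) ≤ |η| := by
    intro y i η hy
    have hr : realMod y p = η + ((i - ⌊y / p⌋ : ℤ) : ℝ) * p := by
      rw [realMod]
      generalize ⌊y / p⌋ = n
      rw [hy]
      push_cast
      ring
    rcases le_or_gt (i - ⌊y / p⌋) 0 with h | h
    · have h' : ((i - ⌊y / p⌋ : ℤ) : ℝ) ≤ 0 := by exact_mod_cast h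
      refine (min_le_left _ _).trans ?_
      rw [hr]
      nlinarith [le_abs_self η]
    · have h' : (1 : ℝ) ≤ ((i - ⌊y / p⌋ : ℤ) : ℝ) := by exact_mod_cast h
      refine (min_le_right _ _).trans ?_
      rw [hr]
      nlinarith [neg_abs_le η]
  rcases abs_choice x with h | h
  · exact key _ j θ (h.trans hx)
  · rw [← abs_neg θ]
    refine key _ (-j) (-θ) ?_
    rw [h, hx]
    push_cast
    ring

/-! ### The basin of attraction -/

/-- The four intervals of half-width `π / 7` around the aligned angles lie in `[0, 2 π]` and are
disjoint, so together they have probability `4 / 7`. -/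
theorem le_uniformAngle {S : Set ℝ}
    (hS : ∀ (j : ℤ) (θ : ℝ), |θ| ≤ Real.pi / 7 → Real.pi / 4 + j * (Real.pi / 2) + θ ∈ S) :
    4 / 7 ≤ uniformAngle S := by
  have hpi := Real.pi_pos
  set I : ℕ → Set ℝ := fun j => Set.Icc (Real.pi / 4 + j * (Real.pi / 2) - Real.pi / 7)
    (Real.pi / 4 + j * (Real.pi / 2) + Real.pi / 7) with hI
  have hsub : (⋃ j ∈ Finset.range 4, I j) ⊆ Set.Icc 0 (2 * Real.pi) ∩ S := by
    intro x hx
    simp only [Set.mem_iUnion, Finset.mem_range] at hx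
    obtain ⟨j, hj, hx⟩ := hx
    have hj' : (j : ℝ) ≤ 3 := by exact_mod_cast Nat.lt_succ_iff.1 hj
    have hj0 : (0 : ℝ) ≤ j := Nat.cast_nonneg j
    refine ⟨⟨by nlinarith [hx.1], by nlinarith [hx.2]⟩, ?_⟩
    have := hS j (x - (Real.pi / 4 + j * (Real.pi / 2)))
      (abs_le.2 ⟨by linarith [hx.1], by linarith [hx.2]⟩)
    convert this using 1
    push_cast
    ring
  have hdisj : (Finset.range 4 : Set ℕ).PairwiseDisjoint I := by
    have key : ∀ i j : ℕ, i < j → Disjoint (I i) (I j) := by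
      intro i j hij
      have hij' : (i : ℝ) + 1 ≤ j := by exact_mod_cast hij
      rw [Set.disjoint_left]
      intro x h1 h2
      nlinarith [h1.2, h2.1]
    intro i _ j _ hij
    rcases lt_or_gt_of_ne hij with h | h
    · exact key i j h
    · exact (key j i h).symm
  have hvol : volume (⋃ j ∈ Finset.range 4, I j) = ENNReal.ofReal (8 * Real.pi / 7) := by
    rw [measure_biUnion_finset hdisj fun _ _ => measurableSet_Icc]
    simp only [hI, Real.volume_Icc]
    rw [Finset.sum_congr rfl (g := fun _ => ENNReal.ofReal (2 * Real.pi / 7))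
      (fun j _ => by congr 1; ring), Finset.sum_const, Finset.card_range, nsmul_eq_mul]
    rw [show ((4 : ℕ) : ℝ≥0∞) = ENNReal.ofReal 4 by simp, ← ENNReal.ofReal_mul (by norm_num)]
    congr 1
    ring
  rw [uniformAngle, cond_apply measurableSet_Icc, Real.volume_Icc, sub_zero]
  refine le_trans ?_ (mul_le_mul_right (measure_mono hsub) _)
  rw [hvol, ← ENNReal.ofReal_inv_of_pos (by positivity), ← ENNReal.ofReal_mul (by positivity),
    show (2 * Real.pi)⁻¹ * (8 * Real.pi / 7) = 4 / 7 by field_simp; norm_num,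
    ENNReal.ofReal_div_of_pos (by norm_num)]
  simp

/-! ### Fredholm operators: kernels, norms, symmetry -/

theorem fredholm_coeFn {K : ℝ × ℝ → ℝ} (hK : MemLp K 2 volume) (f : L2) :
    fredholm K hK f =ᵐ[volume] fun s => ∫ t, K (s, t) * f t :=
  MemLp.coeFn_toLp (memLp_kernel hK (Lp.memLp f))

theorem inner_eq_integral (f g : L2) : ⟪f, g⟫_ℝ = ∫ s, f s * g s := by
  rw [L2.inner_def]
  refine integral_congr_ae (.of_forall fun s => ?_)
  simp [mul_comm]

theorem toReal_eLpNorm_sq {X : Type*} [MeasurableSpace X] {μ : Measure X} {K : X → ℝ}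
    (hK : MemLp K 2 μ) : (eLpNorm K 2 μ).toReal ^ 2 = ∫ p, K p ^ 2 ∂μ := by
  have h0 : 0 ≤ ∫ p, K p ^ 2 ∂μ := integral_nonneg fun p => sq_nonneg _
  rw [hK.eLpNorm_eq_integral_rpow_norm two_ne_zero ENNReal.ofNat_ne_top]
  simp only [ENNReal.toReal_ofNat, Real.rpow_ofNat, Real.norm_eq_abs, sq_abs]
  rw [ENNReal.toReal_ofReal (by positivity), ← Real.rpow_natCast, ← Real.rpow_mul h0]
  norm_num

theorem norm_fredholm_le {K : ℝ × ℝ → ℝ} (hK : MemLp K 2 volume) {B : ℝ} (hB : 0 ≤ B)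
    (h : ∫ p, K p ^ 2 ≤ B ^ 2) : ‖fredholm K hK‖ ≤ B := by
  refine (LinearMap.mkContinuous_norm_le _ ENNReal.toReal_nonneg _).trans ?_
  refine le_of_sq_le_sq ?_ hB
  rwa [toReal_eLpNorm_sq hK]

theorem memLp_tensor {f g : ℝ → ℝ} (hf : MemLp f 2 volume) (hg : MemLp g 2 volume) :
    MemLp (fun p : ℝ × ℝ => f p.1 * g p.2) 2 volume := by
  have hm : AEStronglyMeasurable (fun p : ℝ × ℝ => f p.1 * g p.2)
      ((volume : Measure ℝ).prod volume) := hf.1.comp_fst.mul hg.1.comp_snd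
  refine (memLp_two_iff_integrable_sq hm).2 ?_
  refine (hf.integrable_sq.mul_prod hg.integrable_sq).congr (.of_forall fun p => ?_)
  simp only
  ring

theorem adjoint_fredholm_of_symm {K : ℝ × ℝ → ℝ} (hK : MemLp K 2 volume)
    (hsymm : ∀ s t, K (s, t) = K (t, s)) :
    ContinuousLinearMap.adjoint (fredholm K hK) = fredholm K hK := by
  symm
  rw [ContinuousLinearMap.eq_adjoint_iff]
  intro f g
  have hi : Integrable (Function.uncurry fun s t => K (s, t) * (g s * f t))
      ((volume : Measure ℝ).prod volume) := by
    have := MemLp.integrable_mul hK (memLp_tensor (Lp.memLp g) (Lp.memLp f))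
    exact this
  rw [inner_eq_integral, inner_eq_integral]
  have h1 : ∫ s, fredholm K hK f s * g s = ∫ s, ∫ t, K (s, t) * (g s * f t) := by
    refine integral_congr_ae ?_
    filter_upwards [fredholm_coeFn hK f] with s hs
    rw [hs, ← integral_mul_const]
    refine integral_congr_ae (.of_forall fun t => ?_)
    simp only
    ring
  have h2 : ∫ t, f t * fredholm K hK g t = ∫ t, ∫ s, K (s, t) * (g s * f t) := by
    refine integral_congr_ae ?_
    filter_upwards [fredholm_coeFn hK g] with t ht
    rw [ht, ← integral_const_mul]
    refine integral_congr_ae (.of_forall fun s => ?_)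
    simp only
    rw [hsymm t s]
    ring
  rw [h1, h2, integral_integral_swap hi]

/-! ### The kernel at angle zero -/

theorem rotTemplate_zero_sub {α : ℝ} (hα : α = 1 / √2) (s t : ℝ) :
    rotTemplate α (0 - Real.pi / 4) (s, t) = if |t| ≤ 1 - |s| then 1 else 0 := by
  have h2 : 0 < √2 := by positivity
  have hsq : √2 * √2 = 2 := Real.mul_self_sqrt (by norm_num)
  have e1 : √2 / 2 = 1 / √2 := by field_simp; linarith
  simp only [rotTemplate, template, rot, Set.indicator, Set.mem_ofPred_eq, zero_sub, Real.cos_neg,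
    Real.sin_neg, Real.cos_pi_div_four, Real.sin_pi_div_four, hα, e1]
  congr 1
  rw [show 1 / √2 * s - -(1 / √2) * t = 1 / √2 * (s + t) by ring,
    show -(1 / √2) * s + 1 / √2 * t = 1 / √2 * (t - s) by ring, abs_mul, abs_mul,
    abs_of_pos (by positivity : 0 < 1 / √2),
    mul_le_iff_le_one_right (by positivity), mul_le_iff_le_one_right (by positivity), eq_iff_iff]
  constructor
  · rintro ⟨h1, h2⟩
    rw [abs_le] at h1 h2
    rcases abs_cases s with h | h <;> rcases abs_cases t with h' | h' <;> linarith
  · intro h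
    have := neg_abs_le s
    have := neg_abs_le t
    have := le_abs_self s
    have := le_abs_self t
    constructor <;> rw [abs_le] <;> constructor <;> linarith

/-- The integral of `f` over the section `{t : |s| + |t| ≤ 1}` of the diamond. -/
def sectionIntegral (f : ℝ → ℝ) (s : ℝ) : ℝ := ∫ t in -max (1 - |s|) 0..max (1 - |s|) 0, f t

theorem integral_rotTemplate_mul {α : ℝ} (hα : α = 1 / √2) (f : ℝ → ℝ) (s : ℝ) :
    ∫ t, rotTemplate α (0 - Real.pi / 4) (s, t) * f t = sectionIntegral f s := by
  have h : ∀ t, rotTemplate α (0 - Real.pi / 4) (s, t) * f t =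
      (Set.Icc (-(1 - |s|)) (1 - |s|)).indicator f t := by
    intro t
    rw [rotTemplate_zero_sub hα, Set.indicator]
    simp only [Set.mem_Icc, ← abs_le]
    split_ifs <;> simp
  simp only [h]
  rw [integral_indicator measurableSet_Icc, sectionIntegral]
  rcases le_or_gt 0 (1 - |s|) with hs | hs
  · rw [max_eq_left hs, intervalIntegral.integral_of_le (by linarith), integral_Icc_eq_integral_Ioc]
  · rw [max_eq_right hs.le, Set.Icc_eq_empty (by linarith)]
    simp

theorem sectionIntegral_neg (f : ℝ → ℝ) (s : ℝ) : sectionIntegral f (-s) = sectionIntegral f s := by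
  simp [sectionIntegral]

theorem sectionIntegral_eq_zero (f : ℝ → ℝ) {s : ℝ} (hs : 1 < |s|) : sectionIntegral f s = 0 := by
  rw [sectionIntegral, max_eq_right (by linarith)]
  simp

theorem sectionIntegral_congr {f g : ℝ → ℝ} (h : f =ᵐ[volume] g) :
    sectionIntegral f = sectionIntegral g := by
  funext s
  exact intervalIntegral.integral_congr_ae (h.mono fun t ht _ => ht)

theorem abs_sectionIntegral_le (f : L2) (s : ℝ) : |sectionIntegral f s| ≤ 2 * ‖f‖ := by
  have h0 : 0 ≤ max (1 - |s|) 0 := le_max_right _ _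
  have h1 : max (1 - |s|) 0 ≤ 1 := max_le (by linarith [abs_nonneg s]) zero_le_one
  rw [sectionIntegral]
  generalize max (1 - |s|) 0 = R at h0 h1
  have h2 := L2.inner_indicatorConstLp_one (𝕜 := ℝ) (μ := (volume : Measure ℝ))
    (measurableSet_Icc : MeasurableSet (Set.Icc (-R) R)) measure_Icc_lt_top.ne f
  rw [intervalIntegral.integral_of_le (by linarith), ← integral_Icc_eq_integral_Ioc, ← h2]
  refine (abs_real_inner_le_norm _ _).trans ?_
  gcongr
  rw [norm_indicatorConstLp two_ne_zero ENNReal.ofNat_ne_top, norm_one, one_mul, measureReal_def,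
    Real.volume_Icc, ENNReal.toReal_ofReal (by linarith)]
  calc (R - -R) ^ (1 / (2 : ℝ≥0∞).toReal) ≤ (4 : ℝ) ^ (1 / (2 : ℝ≥0∞).toReal) := by
        refine Real.rpow_le_rpow (by linarith) (by linarith) (by positivity)
    _ = 2 := by
        rw [show (4 : ℝ) = 2 ^ (2 : ℝ) by norm_num, ← Real.rpow_mul (by norm_num)]
        simp

theorem abs_sectionIntegral_le_of_abs_le {f : ℝ → ℝ} {M : ℝ} (hM : ∀ x, |f x| ≤ M) (s : ℝ) :
    |sectionIntegral f s| ≤ 2 * M := by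
  have h0 : 0 ≤ max (1 - |s|) 0 := le_max_right _ _
  have h1 : max (1 - |s|) 0 ≤ 1 := max_le (by linarith [abs_nonneg s]) zero_le_one
  have hM0 : 0 ≤ M := (abs_nonneg _).trans (hM 0)
  rw [sectionIntegral]
  refine (intervalIntegral.norm_integral_le_of_norm_le_const (f := f) (C := M)
    fun x _ => hM x).trans ?_
  rw [abs_of_nonneg (by linarith)]
  nlinarith

theorem abs_sectionIntegral_sub_le {f : ℝ → ℝ} (hf : AEStronglyMeasurable f volume) {M : ℝ}
    (hM : ∀ x, |f x| ≤ M) (s s' : ℝ) :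
    |sectionIntegral f s - sectionIntegral f s'| ≤ 2 * M * |s - s'| := by
  have hi : ∀ a b : ℝ, IntervalIntegrable f volume a b := by
    intro a b
    rw [intervalIntegrable_iff, Set.uIoc]
    exact Integrable.of_bound hf.restrict M (.of_forall hM)
  have hM0 : 0 ≤ M := (abs_nonneg _).trans (hM 0)
  have hR : |max (1 - |s|) 0 - max (1 - |s'|) 0| ≤ |s - s'| := by
    refine (abs_max_sub_max_le_abs _ _ _).trans ?_
    rw [show 1 - |s| - (1 - |s'|) = |s'| - |s| by ring, abs_sub_comm s s']
    exact abs_abs_sub_abs_le _ _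
  rw [sectionIntegral, sectionIntegral]
  generalize max (1 - |s|) 0 = R at *
  generalize max (1 - |s'|) 0 = R' at *
  have h1 : (∫ t in -R..R, f t) - ∫ t in -R'..R', f t =
      (∫ t in -R..-R', f t) + ∫ t in R'..R, f t := by
    rw [← intervalIntegral.integral_add_adjacent_intervals (hi (-R) (-R')) (hi (-R') R),
      ← intervalIntegral.integral_add_adjacent_intervals (hi (-R') R') (hi R' R)]
    ring
  rw [h1]
  have k1 : |∫ t in -R..-R', f t| ≤ M * |-R' - -R| :=
    intervalIntegral.norm_integral_le_of_norm_le_const (f := f) (C := M) fun x _ => hM x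
  have k2 : |∫ t in R'..R, f t| ≤ M * |R - R'| :=
    intervalIntegral.norm_integral_le_of_norm_le_const (f := f) (C := M) fun x _ => hM x
  rw [show -R' - -R = R - R' by ring] at k1
  calc _ ≤ M * |R - R'| + M * |R - R'| := (abs_add_le _ _).trans (add_le_add k1 k2)
    _ = 2 * M * |R - R'| := by ring
    _ ≤ _ := by gcongr

/-! ### The leading eigenfunction -/

theorem memLp_cosBump : MemLp cosBump 2 volume := by
  refine continuous_cosBump.memLp_of_hasCompactSupport
    (HasCompactSupport.intro (isCompact_Icc (a := -1) (b := 1)) fun x hx => ?_)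
  exact cosBump_eq_zero (not_le.1 fun h => hx (abs_le.1 h))

/-- The leading eigenfunction `cos (π s / 2)` on `[-1, 1]`, as an element of `L²(ℝ)`. -/
def cosVec : L2 := memLp_cosBump.toLp cosBump

theorem cosVec_coeFn : cosVec =ᵐ[volume] cosBump := memLp_cosBump.coeFn_toLp

theorem integral_cosBump {r : ℝ} (h0 : 0 ≤ r) (h1 : r ≤ 1) :
    ∫ t in -r..r, cosBump t = 4 / Real.pi * Real.sin (Real.pi / 2 * r) := by
  have h : ∫ t in -r..r, cosBump t = ∫ t in -r..r, Real.cos (Real.pi / 2 * t) := by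
    refine intervalIntegral.integral_congr fun t ht => ?_
    rw [Set.uIcc_of_le (by linarith)] at ht
    have : |t| ≤ 1 := abs_le.2 ⟨by linarith [ht.1], by linarith [ht.2]⟩
    simp [cosBump, this]
  rw [h, intervalIntegral.integral_comp_mul_left _ (by positivity), integral_cos, mul_neg,
    Real.sin_neg, smul_eq_mul]
  field_simp
  ring

theorem sectionIntegral_cosBump (s : ℝ) : sectionIntegral cosBump s = 4 / Real.pi * cosBump s := by
  rcases le_or_gt |s| 1 with h | h
  · rw [sectionIntegral, max_eq_left (by linarith), integral_cosBump (by linarith)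
      (by linarith [abs_nonneg s]), mul_sub, mul_one, Real.sin_pi_div_two_sub, cosBump, if_pos h,
      ← Real.cos_abs (Real.pi / 2 * s), abs_mul, abs_of_pos (by positivity : 0 < Real.pi / 2)]
  · rw [sectionIntegral_eq_zero _ h, cosBump_eq_zero h, mul_zero]

theorem integral_cosBump_sq : ∫ s, cosBump s ^ 2 = 1 := by
  have h : ∀ s, cosBump s ^ 2 =
      (Set.Icc (-1) 1).indicator (fun s => Real.cos (Real.pi / 2 * s) ^ 2) s := by
    intro s
    simp only [cosBump, Set.indicator, Set.mem_Icc, ← abs_le]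
    split_ifs <;> simp
  simp only [h]
  rw [integral_indicator measurableSet_Icc, integral_Icc_eq_integral_Ioc,
    ← intervalIntegral.integral_of_le (by norm_num),
    intervalIntegral.integral_comp_mul_left (fun x => Real.cos x ^ 2) (by positivity),
    integral_cos_sq]
  simp

theorem norm_cosVec : ‖cosVec‖ = 1 := by
  have h : ‖cosVec‖ ^ 2 = 1 := by
    rw [cosVec, Lp.norm_toLp, toReal_eLpNorm_sq memLp_cosBump, integral_cosBump_sq]
  exact (pow_eq_one_iff_of_nonneg (norm_nonneg _) two_ne_zero).1 h

theorem inner_pulse (a : ℝ) (f : L2) : ⟪pulse a, f⟫_ℝ = ∫ t in Set.Icc (-a) a, f t :=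
  L2.inner_indicatorConstLp_one (𝕜 := ℝ) _ _ f

theorem inner_pulse_cosVec {a : ℝ} (h0 : 0 ≤ a) (h1 : a ≤ 1) :
    ⟪pulse a, cosVec⟫_ℝ = 4 / Real.pi * Real.sin (Real.pi / 2 * a) := by
  rw [inner_pulse, ← integral_cosBump h0 h1, intervalIntegral.integral_of_le (by linarith),
    ← integral_Icc_eq_integral_Ioc]
  exact integral_congr_ae (ae_restrict_of_ae cosVec_coeFn)

theorem norm_pulse_sq {a : ℝ} (ha : 0 ≤ a) : ‖pulse a‖ ^ 2 = 2 * a := by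
  rw [← real_inner_self_eq_norm_sq, inner_pulse]
  have h := indicatorConstLp_coeFn (p := 2) (hs := (measurableSet_Icc : MeasurableSet
    (Set.Icc (-a) a))) (hμs := (measure_Icc_lt_top (μ := (volume : Measure ℝ))).ne) (c := (1 : ℝ))
  have h2 : ∫ t in Set.Icc (-a) a, pulse a t = ∫ t in Set.Icc (-a) a, (1 : ℝ) := by
    refine setIntegral_congr_ae measurableSet_Icc ?_
    filter_upwards [h] with t ht hmem
    rw [pulse, ht, Set.indicator_of_mem hmem]
  rw [h2]
  simp [Real.volume_real_Icc_of_le (by linarith : -a ≤ a)]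
  ring

/-! ### The spectral gap at angle zero -/

section SpectralGap

/-- The Fredholm operator of the template tilted by `π / 4`, which is the diamond
`{|s| + |t| ≤ 1}` when `α = 1 / √2`. -/
def diamondOp (α : ℝ) : L2 →L[ℝ] L2 :=
  fredholm (rotTemplate α (0 - Real.pi / 4)) (memLp_rotTemplate α (0 - Real.pi / 4))

variable {α : ℝ}

theorem diamondOp_coeFn (hα : α = 1 / √2) (f : L2) :
    diamondOp α f =ᵐ[volume] sectionIntegral f := by
  filter_upwards [fredholm_coeFn (memLp_rotTemplate α (0 - Real.pi / 4)) f] with s hs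
  rw [diamondOp, hs, integral_rotTemplate_mul hα]

theorem adjoint_diamondOp (hα : α = 1 / √2) :
    ContinuousLinearMap.adjoint (diamondOp α) = diamondOp α := by
  refine adjoint_fredholm_of_symm _ fun s t => ?_
  rw [rotTemplate_zero_sub hα, rotTemplate_zero_sub hα]
  congr 1
  rw [eq_iff_iff]
  constructor <;> intro h <;> linarith

theorem inner_diamondOp_left (hα : α = 1 / √2) (f g : L2) :
    ⟪diamondOp α f, g⟫_ℝ = ⟪f, diamondOp α g⟫_ℝ := by
  rw [← ContinuousLinearMap.adjoint_inner_right, adjoint_diamondOp hα]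

theorem symOp_zero (hα : α = 1 / √2) : symOp α (Real.pi / 4) 0 = (2 : ℝ) • diamondOp α := by
  change diamondOp α + ContinuousLinearMap.adjoint (diamondOp α) = _
  rw [adjoint_diamondOp hα, two_smul]

theorem diamondOp_cosVec (hα : α = 1 / √2) :
    diamondOp α cosVec = (4 / Real.pi) • cosVec := by
  refine Lp.ext ?_
  filter_upwards [diamondOp_coeFn hα cosVec, Lp.coeFn_smul (4 / Real.pi) cosVec, cosVec_coeFn]
    with s h1 h2 h3
  rw [h1, h2, Pi.smul_apply, h3, sectionIntegral_congr cosVec_coeFn, sectionIntegral_cosBump,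
    smul_eq_mul]

theorem integral_rotTemplate_sq (hα : α = 1 / √2) (θ : ℝ) : ∫ p, rotTemplate α θ p ^ 2 = 2 := by
  have h0 : 0 < √2 := by positivity
  have hsq : √2 * √2 = 2 := Real.mul_self_sqrt (by norm_num)
  have hα0 : 0 < α := by rw [hα]; positivity
  have hα2 : α ^ 2 = 1 / 2 := by rw [hα, div_pow, Real.sq_sqrt (by norm_num), one_pow]
  have h1 : ∀ p, rotTemplate α θ p ^ 2 = template α (rot θ p) := by
    intro p
    simp only [rotTemplate, template, Set.indicator]
    split_ifs <;> norm_num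
  simp only [h1]
  rw [integral_comp_rot, template.eq_def, integral_indicator (measurableSet_square α), square_eq,
    setIntegral_const, smul_eq_mul, mul_one, Measure.volume_eq_prod, measureReal_prod_prod,
    Real.volume_real_Icc_of_le (by linarith)]
  linear_combination 4 * hα2

/-- On the orthogonal complement of the leading eigenfunction the diamond operator is at most half
as large as its leading eigenvalue `4 / π`: the deflated kernel has squared Hilbert–Schmidt norm
`2 - (4 / π)²`. -/
theorem norm_diamondOp_le (hα : α = 1 / √2) {e : L2} (he : ⟪cosVec, e⟫_ℝ = 0) :
    ‖diamondOp α e‖ ≤ 2 / Real.pi * ‖e‖ := by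
  set K := rotTemplate α (0 - Real.pi / 4) with hKdef
  have hK : MemLp K 2 volume := memLp_rotTemplate α _
  have hc := memLp_tensor memLp_cosBump memLp_cosBump
  have hK' : MemLp (fun p : ℝ × ℝ => K p - 4 / Real.pi * (cosBump p.1 * cosBump p.2)) 2 volume :=
    hK.sub (hc.const_mul (4 / Real.pi))
  have hce : ∫ t, cosBump t * e t = 0 := by
    rw [← he, inner_eq_integral]
    refine integral_congr_ae ?_
    filter_upwards [cosVec_coeFn] with t ht
    rw [ht]
  have heq : diamondOp α e = fredholm _ hK' e := by
    refine Lp.ext ?_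
    filter_upwards [fredholm_coeFn hK' e, fredholm_coeFn hK e, ae_memLp_section hK] with s h1 h2 h3
    have i1 : Integrable (fun t => K (s, t) * e t) volume := h3.integrable_mul (Lp.memLp e)
    have i2 : Integrable (fun t => cosBump t * e t) volume :=
      memLp_cosBump.integrable_mul (Lp.memLp e)
    change fredholm K hK e s = _
    rw [h1, h2]
    have h4 : ∀ t, (K (s, t) - 4 / Real.pi * (cosBump s * cosBump t)) * e t =
        K (s, t) * e t - 4 / Real.pi * cosBump s * (cosBump t * e t) := fun t => by ring
    simp only [h4]
    rw [integral_sub i1 (i2.const_mul _), integral_const_mul, hce, mul_zero, sub_zero]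
  rw [heq]
  refine (ContinuousLinearMap.le_opNorm _ _).trans ?_
  gcongr
  refine norm_fredholm_le hK' (by positivity) ?_
  have j1 : Integrable (fun p => K p ^ 2) volume := hK.integrable_sq
  have j2 : Integrable (fun p : ℝ × ℝ => K p * (cosBump p.1 * cosBump p.2)) volume :=
    hK.integrable_mul hc
  have j3 : Integrable (fun p : ℝ × ℝ => (cosBump p.1 * cosBump p.2) ^ 2) volume :=
    hc.integrable_sq
  have k2 : ∫ p : ℝ × ℝ, K p * (cosBump p.1 * cosBump p.2) = 4 / Real.pi := by
    rw [Measure.volume_eq_prod, integral_prod _ j2]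
    have : ∀ s, ∫ t, K (s, t) * (cosBump s * cosBump t) = 4 / Real.pi * cosBump s ^ 2 := by
      intro s
      have h5 : ∀ t, K (s, t) * (cosBump s * cosBump t) =
        cosBump s * (K (s, t) * cosBump t) := fun t => by ring
      simp only [h5]
      rw [integral_const_mul, integral_rotTemplate_mul hα, sectionIntegral_cosBump]
      ring
    simp only [this]
    rw [integral_const_mul, integral_cosBump_sq, mul_one]
  have k3 : ∫ p : ℝ × ℝ, (cosBump p.1 * cosBump p.2) ^ 2 = 1 := by
    simp only [mul_pow]
    rw [Measure.volume_eq_prod, integral_prod_mul (fun s => cosBump s ^ 2) fun s => cosBump s ^ 2,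
      integral_cosBump_sq, mul_one]
  have hexp : ∀ p : ℝ × ℝ, (K p - 4 / Real.pi * (cosBump p.1 * cosBump p.2)) ^ 2 =
      K p ^ 2 - 8 / Real.pi * (K p * (cosBump p.1 * cosBump p.2)) +
        (4 / Real.pi) ^ 2 * (cosBump p.1 * cosBump p.2) ^ 2 := fun p => by ring
  simp only [hexp]
  have j12 : Integrable (fun p : ℝ × ℝ => K p ^ 2 -
      8 / Real.pi * (K p * (cosBump p.1 * cosBump p.2))) volume := j1.sub (j2.const_mul _)
  rw [integral_add j12 (j3.const_mul _), integral_sub j1 (j2.const_mul _),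
    integral_const_mul, integral_const_mul, integral_rotTemplate_sq hα, k2, k3]
  have hpi := Real.pi_pos
  have hpi2 : Real.pi ^ 2 ≤ 10 := by nlinarith [Real.pi_lt_d4]
  have h6 : (0 : ℝ) ≤ 20 / Real.pi ^ 2 - 2 := by
    rw [sub_nonneg, le_div_iff₀ (by positivity)]
    linarith
  have h7 : (2 / Real.pi) ^ 2 - (2 - 8 / Real.pi * (4 / Real.pi) + (4 / Real.pi) ^ 2 * 1) =
      20 / Real.pi ^ 2 - 2 := by
    field_simp
    ring
  linarith

end SpectralGap

/-! ### The power method at angle zero -/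

section PowerMethod

variable {α : ℝ}

/-- The relative error of the `k`-th power iterate at angle zero, started from `pulse 1`. -/
def errIter (α : ℝ) : ℕ → L2
  | 0 => (Real.pi / 4) • pulse 1 - cosVec
  | k + 1 => (Real.pi / 4) • diamondOp α (errIter α k)

theorem inner_cosVec_errIter (hα : α = 1 / √2) (k : ℕ) : ⟪cosVec, errIter α k⟫_ℝ = 0 := by
  induction k with
  | zero =>
    rw [errIter, inner_sub_right, inner_smul_right, real_inner_comm,
      inner_pulse_cosVec zero_le_one le_rfl, real_inner_self_eq_norm_sq, norm_cosVec, mul_one,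
      Real.sin_pi_div_two]
    field_simp
    norm_num
  | succ k ih =>
    rw [errIter, inner_smul_right, ← inner_diamondOp_left hα, diamondOp_cosVec hα,
      real_inner_smul_left, ih, mul_zero, mul_zero]

theorem norm_errIter_le (hα : α = 1 / √2) (k : ℕ) : ‖errIter α k‖ ≤ 3 * (1 / 2) ^ k := by
  have hpi := Real.pi_pos
  induction k with
  | zero =>
    have h1 : ‖pulse 1‖ ≤ 2 := by
      refine le_of_sq_le_sq ?_ (by norm_num)
      rw [norm_pulse_sq zero_le_one]
      norm_num
    refine (norm_sub_le _ _).trans ?_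
    rw [norm_smul, norm_cosVec, Real.norm_of_nonneg (by positivity)]
    nlinarith [Real.pi_lt_d2]
  | succ k ih =>
    rw [errIter, norm_smul, Real.norm_of_nonneg (by positivity)]
    calc Real.pi / 4 * ‖diamondOp α (errIter α k)‖
        ≤ Real.pi / 4 * (2 / Real.pi * ‖errIter α k‖) := by
          gcongr
          exact norm_diamondOp_le hα (inner_cosVec_errIter hα k)
      _ = 1 / 2 * ‖errIter α k‖ := by field_simp; norm_num
      _ ≤ 1 / 2 * (3 * (1 / 2) ^ k) := by gcongr
      _ = _ := by ring

theorem norm_cosVec_add_errIter_sq (hα : α = 1 / √2) (k : ℕ) :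
    ‖cosVec + errIter α k‖ ^ 2 = 1 + ‖errIter α k‖ ^ 2 := by
  rw [norm_add_sq_real, inner_cosVec_errIter hα, norm_cosVec]
  ring

theorem norm_cosVec_add_errIter_pos (hα : α = 1 / √2) (k : ℕ) : 0 < ‖cosVec + errIter α k‖ := by
  have h := norm_cosVec_add_errIter_sq hα k
  refine (norm_nonneg _).lt_of_ne fun h0 => ?_
  rw [← h0] at h
  nlinarith [sq_nonneg ‖errIter α k‖]

theorem symOp_zero_apply (hα : α = 1 / √2) (k : ℕ) :
    symOp α (Real.pi / 4) 0 (cosVec + errIter α k) =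
      (8 / Real.pi) • (cosVec + errIter α (k + 1)) := by
  rw [symOp_zero hα, smul_apply, map_add, diamondOp_cosVec hα, errIter,
    smul_add, smul_add, smul_smul, smul_smul]
  have hpi := Real.pi_pos
  congr 2
  · ring
  · field_simp; norm_num

theorem powerIter_succ_eq (hα : α = 1 / √2) (k : ℕ) :
    powerIter (symOp α (Real.pi / 4) 0) (pulse 1) (k + 1) =
      ‖cosVec + errIter α (k + 1)‖⁻¹ • (cosVec + errIter α (k + 1)) := by
  have hpi := Real.pi_pos
  have step : ∀ {s : ℝ} {f : L2} (k : ℕ), 0 < s → f = s • (cosVec + errIter α k) →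
      ‖symOp α (Real.pi / 4) 0 f‖⁻¹ • symOp α (Real.pi / 4) 0 f =
        ‖cosVec + errIter α (k + 1)‖⁻¹ • (cosVec + errIter α (k + 1)) := by
    intro s f k hs hf
    have hx := norm_cosVec_add_errIter_pos hα (k + 1)
    rw [hf, map_smul, symOp_zero_apply hα, smul_smul s, norm_smul, smul_smul,
      Real.norm_of_nonneg (by positivity)]
    congr 1
    field_simp
  induction k with
  | zero =>
    refine step (s := 4 / Real.pi) 0 (by positivity) ?_
    rw [powerIter, errIter, add_sub_cancel, smul_smul]
    rw [show 4 / Real.pi * (Real.pi / 4) = 1 by field_simp, one_smul]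
  | succ k ih => exact step (k + 1) (inv_pos.2 (norm_cosVec_add_errIter_pos hα _)) ih

theorem errIter_coeFn (hα : α = 1 / √2) (k : ℕ) :
    errIter α (k + 2) =ᵐ[volume] fun s =>
      (Real.pi / 4) ^ 2 * sectionIntegral (sectionIntegral (errIter α k)) s := by
  have h1 : errIter α (k + 2) =
      ((Real.pi / 4) * (Real.pi / 4)) • diamondOp α (diamondOp α (errIter α k)) := by
    rw [errIter, errIter, map_smul, smul_smul]
  rw [h1]
  filter_upwards [Lp.coeFn_smul ((Real.pi / 4) * (Real.pi / 4))
    (diamondOp α (diamondOp α (errIter α k))), diamondOp_coeFn hα (diamondOp α (errIter α k))]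
    with s h2 h3
  rw [h2, Pi.smul_apply, h3, sectionIntegral_congr (diamondOp_coeFn hα (errIter α k)), smul_eq_mul,
    sq]

/-- After sixteen iterations the rough representation is a profile: two applications of the
integral operator turn the tiny `L²` error into a tiny Lipschitz error. -/
theorem exists_isProfile_uRough (hα : α = 1 / √2) {k : ℕ} (hk : 16 ≤ k) :
    ∃ (m : ℝ) (e : ℝ → ℝ) (E : L2), IsProfile m e ∧
      uRough α (Real.pi / 4) k =ᵐ[volume] profile m e ∧
      uRough α (Real.pi / 4) k = m • (cosVec + E) ∧ ‖E‖ ≤ 1 / 1000 := by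
  have hpi := Real.pi_pos
  have hpi3 := Real.pi_gt_d2
  have hpi4 := Real.pi_lt_d2
  obtain ⟨n, rfl⟩ : ∃ n, k = n + 2 := ⟨k - 2, by omega⟩
  have hn : ‖errIter α n‖ ≤ 1 / 5000 := by
    refine (norm_errIter_le hα n).trans ?_
    calc (3 : ℝ) * (1 / 2) ^ n ≤ 3 * (1 / 2) ^ 14 := by
          gcongr 3 * ?_
          exact pow_le_pow_of_le_one (by norm_num) (by norm_num) (by omega)
      _ ≤ _ := by norm_num
  have hE : ‖errIter α (n + 2)‖ ≤ 1 / 1000 := by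
    refine (norm_errIter_le hα (n + 2)).trans ?_
    calc (3 : ℝ) * (1 / 2) ^ (n + 2) ≤ 3 * (1 / 2) ^ 16 := by
          gcongr 3 * ?_
          exact pow_le_pow_of_le_one (by norm_num) (by norm_num) (by omega)
      _ ≤ _ := by norm_num
  set E := errIter α (n + 2) with hEdef
  set x := cosVec + E with hx
  have hxpos : 0 < ‖x‖ := norm_cosVec_add_errIter_pos hα (n + 2)
  have hxsq : ‖x‖ ^ 2 = 1 + ‖E‖ ^ 2 := norm_cosVec_add_errIter_sq hα (n + 2)
  have hcE : ⟪cosVec, E⟫_ℝ = 0 := inner_cosVec_errIter hα (n + 2)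
  have hpow : powerIter (symOp α (Real.pi / 4) 0) (pulse 1) (n + 2) = ‖x‖⁻¹ • x :=
    powerIter_succ_eq hα (n + 1)
  have hcE' : ⟪cosVec, errIter α (n + 2 + 1)⟫_ℝ = 0 := inner_cosVec_errIter hα _
  have hEn : ‖errIter α (n + 2 + 1)‖ ≤ 1 := by
    refine (norm_errIter_le hα _).trans ?_
    calc (3 : ℝ) * (1 / 2) ^ (n + 2 + 1) ≤ 3 * (1 / 2) ^ 2 := by
          gcongr 3 * ?_
          exact pow_le_pow_of_le_one (by norm_num) (by norm_num) (by omega)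
      _ ≤ _ := by norm_num
  set q := ⟪E, errIter α (n + 2 + 1)⟫_ℝ with hq
  have hqb : |q| ≤ 1 / 1000 := (abs_real_inner_le_norm _ _).trans (by nlinarith [norm_nonneg E])
  have hq' := abs_le.1 hqb
  have hray : 1 / 2 * ⟪‖x‖⁻¹ • x, symOp α (Real.pi / 4) 0 (‖x‖⁻¹ • x)⟫_ℝ =
      4 / Real.pi * (1 + q) / ‖x‖ ^ 2 := by
    rw [map_smul, symOp_zero_apply hα, real_inner_smul_left, real_inner_smul_right,
      real_inner_smul_right, hx, inner_add_left, inner_add_right, inner_add_right,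
      real_inner_self_eq_norm_sq, norm_cosVec, hcE', real_inner_comm, hcE, ← hx]
    field_simp
    ring
  have hu : uRough α (Real.pi / 4) (n + 2) =
      (√(4 / Real.pi * (1 + q) / ‖x‖ ^ 2) * ‖x‖⁻¹) • x := by
    rw [uRough, powerMethod, hpow, hray, smul_smul]
  set m := √(4 / Real.pi * (1 + q) / ‖x‖ ^ 2) * ‖x‖⁻¹ with hm
  have hxs1 : 1 ≤ ‖x‖ ^ 2 := by rw [hxsq]; nlinarith [sq_nonneg ‖E‖]
  have hxs2 : ‖x‖ ^ 2 ≤ 1.001 := by rw [hxsq]; nlinarith [norm_nonneg E]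
  have hnum : 0 < 4 / Real.pi * (1 + q) := mul_pos (by positivity) (by linarith)
  have hm2 : m ^ 2 = 4 / Real.pi * (1 + q) / (‖x‖ ^ 2) ^ 2 := by
    rw [hm, mul_pow, Real.sq_sqrt (by positivity)]
    field_simp
  have hl1 : (1.25 : ℝ) ≤ 4 / Real.pi := by rw [le_div_iff₀ hpi]; linarith
  have hl2 : 4 / Real.pi ≤ 1.3 := by rw [div_le_iff₀ hpi]; linarith
  refine ⟨m, fun s => (Real.pi / 4) ^ 2 * sectionIntegral (sectionIntegral (errIter α n)) s, E,
    ?_, ?_, hu, hE⟩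
  · have hb : ∀ s, |sectionIntegral (errIter α n) s| ≤ 2 * (1 / 5000) := fun s =>
      (abs_sectionIntegral_le _ s).trans (by gcongr)
    have hms : AEStronglyMeasurable (sectionIntegral (errIter α n)) volume :=
      (Lp.memLp (diamondOp α (errIter α n))).1.congr (diamondOp_coeFn hα _)
    have hc : (Real.pi / 4) ^ 2 ≤ 0.625 := by nlinarith
    have hc0 : 0 ≤ (Real.pi / 4) ^ 2 := sq_nonneg _
    refine ⟨by positivity, ?_, ?_, ?_, ?_, ?_, ?_⟩
    · rw [hm2, le_div_iff₀ (by positivity)]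
      nlinarith
    · rw [hm2, div_le_iff₀ (by positivity)]
      nlinarith
    · intro s
      rw [sectionIntegral_neg]
    · intro s
      rw [abs_mul, abs_of_nonneg hc0]
      calc _ ≤ 0.625 * (2 * (2 * (1 / 5000))) := by
            gcongr
            exact abs_sectionIntegral_le_of_abs_le hb s
        _ ≤ (1 : ℝ) / 2000 := by norm_num
    · intro s t
      rw [← mul_sub, abs_mul, abs_of_nonneg hc0]
      calc _ ≤ 0.625 * (2 * (2 * (1 / 5000)) * |s - t|) := by
            gcongr
            exact abs_sectionIntegral_sub_le hms hb s t
        _ = 0.0005 * |s - t| := by ring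
        _ ≤ 1 / 2000 * |s - t| := by norm_num
    · intro s hs
      rw [sectionIntegral_eq_zero _ hs, mul_zero]
  · rw [hu]
    filter_upwards [Lp.coeFn_smul m x, Lp.coeFn_add cosVec E, cosVec_coeFn, errIter_coeFn hα n]
      with s h1 h2 h3 h4
    rw [h1, Pi.smul_apply, h2, Pi.add_apply, h3, h4, profile, smul_eq_mul]

end PowerMethod

/-! ### Power iteration for a perturbed rank-one operator -/

section RankOne

variable {H : Type*} [NormedAddCommGroup H] [InnerProductSpace ℝ H] {A : H →L[ℝ] H} {n : H}
  {N h : ℝ}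

theorem norm_sq_sub_inner_sq_le (hn : ‖n‖ = 1)
    (hA : ∀ x, ‖A x - (2 * N * ⟪n, x⟫_ℝ) • n‖ ≤ 2 * h * ‖x‖) (x : H) :
    ‖A x‖ ^ 2 - ⟪n, A x⟫_ℝ ^ 2 ≤ (2 * h * ‖x‖) ^ 2 := by
  set r := A x - (2 * N * ⟪n, x⟫_ℝ) • n with hr
  have hz : A x = (2 * N * ⟪n, x⟫_ℝ) • n + r := by rw [hr]; abel
  have h1 : ‖r‖ ^ 2 ≤ (2 * h * ‖x‖) ^ 2 := pow_le_pow_left₀ (norm_nonneg _) (hA x) 2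
  rw [hz, norm_add_sq_real, inner_add_right, real_inner_smul_left, real_inner_smul_right,
    real_inner_self_eq_norm_sq, norm_smul, hn, mul_one, Real.norm_eq_abs, sq_abs]
  nlinarith [sq_nonneg ⟪n, r⟫_ℝ]

theorem abs_inner_sub_le (hn : ‖n‖ = 1)
    (hA : ∀ x, ‖A x - (2 * N * ⟪n, x⟫_ℝ) • n‖ ≤ 2 * h * ‖x‖) (x : H) :
    |⟪n, A x⟫_ℝ - 2 * N * ⟪n, x⟫_ℝ| ≤ 2 * h * ‖x‖ := by
  have h1 := (abs_real_inner_le_norm n (A x - (2 * N * ⟪n, x⟫_ℝ) • n)).trans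
    (mul_le_mul_of_nonneg_left (hA x) (norm_nonneg n))
  rwa [inner_sub_right, real_inner_smul_right, real_inner_self_eq_norm_sq, hn, one_pow, mul_one,
    one_mul] at h1

/-- One normalized step from a vector at a fixed angle to `n` lands at an angle `O(h)` from `n`. -/
theorem normalized_step (hn : ‖n‖ = 1) (hN : 1.414 ≤ N) (h1 : h ≤ 0.177)
    (hA : ∀ x, ‖A x - (2 * N * ⟪n, x⟫_ℝ) • n‖ ≤ 2 * h * ‖x‖) {x : H} (hx0 : x ≠ 0)
    (hx : 0.7 * ‖x‖ ≤ ⟪n, x⟫_ℝ) :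
    ‖‖A x‖⁻¹ • A x‖ = 1 ∧ 0 < ⟪n, ‖A x‖⁻¹ • A x⟫_ℝ ∧
      1 - ⟪n, ‖A x‖⁻¹ • A x⟫_ℝ ^ 2 ≤ 25 / 16 * h ^ 2 := by
  have hxp : 0 < ‖x‖ := norm_pos_iff.2 hx0
  have hp : 1.6 * ‖x‖ ≤ ⟪n, A x⟫_ℝ := by
    have k1 := (abs_le.1 (abs_inner_sub_le hn hA x)).1
    have k2 : 1.414 * (0.7 * ‖x‖) ≤ N * ⟪n, x⟫_ℝ := by gcongr
    have k3 : h * ‖x‖ ≤ 0.177 * ‖x‖ := by gcongr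
    linarith
  have hp0 : 0 < ⟪n, A x⟫_ℝ := lt_of_lt_of_le (by positivity) hp
  have hz0 : 0 < ‖A x‖ := by
    refine norm_pos_iff.2 fun h => ?_
    rw [h, inner_zero_right] at hp0
    exact lt_irrefl _ hp0
  have hpz : ⟪n, A x⟫_ℝ ≤ ‖A x‖ := by
    have := real_inner_le_norm n (A x)
    rwa [hn, one_mul] at this
  refine ⟨?_, ?_, ?_⟩
  · rw [norm_smul, norm_inv, norm_norm, inv_mul_cancel₀ hz0.ne']
  · rw [real_inner_smul_right]
    positivity
  · rw [real_inner_smul_right]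
    have k4 := norm_sq_sub_inner_sq_le hn hA x
    have k5 : 1 - (‖A x‖⁻¹ * ⟪n, A x⟫_ℝ) ^ 2 = (‖A x‖ ^ 2 - ⟪n, A x⟫_ℝ ^ 2) / ‖A x‖ ^ 2 := by
      field_simp
    rw [k5, div_le_iff₀ (by positivity)]
    have k6 : (1.6 * ‖x‖) ^ 2 ≤ ‖A x‖ ^ 2 := by gcongr; linarith
    nlinarith [sq_nonneg h]

/-- A unit vector at angle `O(h)` from `n`, scaled by the root of its Rayleigh quotient, is
`O(h)`-close to the factor of the unperturbed rank-one operator. -/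
theorem norm_rayleigh_sub_sq_le (hn : ‖n‖ = 1) (hN : 1.414 ≤ N) (hN' : N ≤ 1.415)
    (h1 : h ≤ 0.177) (hA : ∀ x, ‖A x - (2 * N * ⟪n, x⟫_ℝ) • n‖ ≤ 2 * h * ‖x‖) {y : H}
    (hy : ‖y‖ = 1) (hc0 : 0 < ⟪n, y⟫_ℝ) (hc : 1 - ⟪n, y⟫_ℝ ^ 2 ≤ 25 / 16 * h ^ 2) :
    ‖√(1 / 2 * ⟪y, A y⟫_ℝ) • y - √N • n‖ ^ 2 ≤ 7 * h ^ 2 := by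
  have hsymm : ⟪y, n⟫_ℝ = ⟪n, y⟫_ℝ := real_inner_comm _ _
  have hr : |1 / 2 * ⟪y, A y⟫_ℝ - N * ⟪n, y⟫_ℝ ^ 2| ≤ h := by
    have k1 := (abs_real_inner_le_norm y (A y - (2 * N * ⟪n, y⟫_ℝ) • n)).trans
      (mul_le_mul_of_nonneg_left (hA y) (norm_nonneg y))
    rw [inner_sub_right, real_inner_smul_right, hy, one_mul, mul_one, hsymm] at k1
    rw [abs_le] at k1 ⊢
    constructor <;> linarith [k1.1, k1.2]
  have hc1 : ⟪n, y⟫_ℝ ≤ 1 := by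
    have := real_inner_le_norm n y
    rwa [hn, hy, one_mul] at this
  have h0 : 0 ≤ h := (abs_nonneg _).trans hr
  have hexp : ∀ l w : ℝ, 0 ≤ l → 0 ≤ w → ‖l • y - w • n‖ ^ 2 =
      (l - w) ^ 2 + 2 * l * w * (1 - ⟪n, y⟫_ℝ) := by
    intro l w hl hw
    rw [norm_sub_sq_real, norm_smul, norm_smul, hy, hn, real_inner_smul_left,
      real_inner_smul_right, hsymm, Real.norm_of_nonneg hl, Real.norm_of_nonneg hw]
    ring
  rw [hexp _ _ (Real.sqrt_nonneg _) (Real.sqrt_nonneg _)]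
  rw [abs_le] at hr
  clear hexp hA hy hn hsymm
  generalize ⟪n, y⟫_ℝ = c at *
  generalize 1 / 2 * ⟪y, A y⟫_ℝ = Q at *
  have hh : h ^ 2 ≤ 0.177 * h := by rw [sq]; gcongr
  have hNc : N * (1 - c ^ 2) ≤ 1.415 * (25 / 16 * h ^ 2) :=
    mul_le_mul hN' hc (by nlinarith) (by norm_num)
  have hNc0 : 0 ≤ N * (1 - c ^ 2) := mul_nonneg (by linarith) (by nlinarith)
  have d1 : N - Q ≤ 1.4 * h := by linarith
  have d2 : Q - N ≤ 1.4 * h := by linarith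
  have hl2 := Real.sq_sqrt (by linarith : 0 ≤ Q)
  have hs2 := Real.sq_sqrt (by linarith : 0 ≤ N)
  have hl0 := Real.sqrt_nonneg Q
  have hs0 : 1 ≤ √N := Real.one_le_sqrt.2 (by linarith)
  generalize √Q = l at *
  generalize √N = w at *
  have e1 : (l - w) ^ 2 ≤ (Q - N) ^ 2 := by
    have : Q - N = (l - w) * (l + w) := by rw [← hl2, ← hs2]; ring
    rw [this, mul_pow]
    exact le_mul_of_one_le_right (sq_nonneg _) (one_le_pow₀ (by linarith))
  have e2 : (Q - N) ^ 2 ≤ (1.4 * h) ^ 2 := sq_le_sq' (by linarith) d2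
  have e3 : 2 * l * w ≤ 3.1 := by linarith [sq_nonneg (l - w), sub_sq l w]
  have e4 : 1 - c ≤ 25 / 16 * h ^ 2 := by
    have : c ^ 2 ≤ c := by rw [sq]; exact mul_le_of_le_one_left hc0.le hc1
    linarith
  have e5 : 2 * l * w * (1 - c) ≤ 3.1 * (25 / 16 * h ^ 2) :=
    mul_le_mul e3 e4 (by linarith) (by norm_num)
  have e6 := sq_nonneg h
  rw [mul_pow] at e2
  linarith

end RankOne

/-! ### The operator of a slightly tilted square -/

theorem template_eq_one {a : ℝ} {p : ℝ × ℝ} (hp : |p.1| ≤ a ∧ |p.2| ≤ a) : template a p = 1 := by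
  rw [template]
  exact Set.indicator_of_mem (s := {p : ℝ × ℝ | |p.1| ≤ a ∧ |p.2| ≤ a}) hp _

/-- The overlap of the square with its rotation contains a square that is smaller by the factor
`1 + |θ|`. -/
theorem integral_rotTemplate_sub_sq_le {α : ℝ} (hα : α = 1 / √2) (θ : ℝ) :
    ∫ p, (rotTemplate α θ p - template α p) ^ 2 ≤ 8 * |θ| := by
  have hα0 : 0 < α := by rw [hα]; positivity
  have hα2 : α ^ 2 = 1 / 2 := by rw [hα, div_pow, Real.sq_sqrt (by norm_num), one_pow]
  have hθ := abs_nonneg θ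
  have i1 : Integrable (fun p => rotTemplate α θ p ^ 2) volume :=
    (memLp_rotTemplate α θ).integrable_sq
  have hrot0 : rotTemplate α 0 = template α := by
    funext p
    simp [rotTemplate, rot]
  have ht2 : MemLp (template α) 2 volume := hrot0 ▸ memLp_rotTemplate α 0
  have i2 : Integrable (fun p => template α p ^ 2) volume := ht2.integrable_sq
  have i3 : Integrable (fun p => rotTemplate α θ p * template α p) volume :=
    (memLp_rotTemplate α θ).integrable_mul ht2
  have v2 : ∫ p, template α p ^ 2 = 2 := by rw [← hrot0]; exact integral_rotTemplate_sq hα 0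
  have hsmall : ∫ p, template (α / (1 + |θ|)) p = 4 * (α / (1 + |θ|)) ^ 2 := by
    have : 0 < α / (1 + |θ|) := by positivity
    rw [template.eq_def, integral_indicator (measurableSet_square _), square_eq,
      setIntegral_const, smul_eq_mul, mul_one, Measure.volume_eq_prod, measureReal_prod_prod,
      Real.volume_real_Icc_of_le (by linarith)]
    ring
  have hle : ∫ p, template (α / (1 + |θ|)) p ≤ ∫ p, rotTemplate α θ p * template α p := by
    refine integral_mono (integrable_template _) i3 fun p => ?_
    have hnn : 0 ≤ rotTemplate α θ p * template α p :=
      mul_nonneg (Set.indicator_nonneg (fun _ _ => zero_le_one) _)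
        (Set.indicator_nonneg (fun _ _ => zero_le_one) _)
    by_cases hp : |p.1| ≤ α / (1 + |θ|) ∧ |p.2| ≤ α / (1 + |θ|)
    · have hp1 := hp.1
      have hp2 := hp.2
      rw [le_div_iff₀ (by positivity)] at hp1 hp2
      have ha := abs_nonneg p.1
      have hb := abs_nonneg p.2
      have c1 := Real.abs_cos_le_one θ
      have s1 : |Real.sin θ| ≤ |θ| := Real.abs_sin_le_abs
      have hmem1 : |p.1| ≤ α ∧ |p.2| ≤ α := ⟨by nlinarith, by nlinarith⟩
      have hR : α / (1 + |θ|) + |θ| * (α / (1 + |θ|)) = α := by field_simp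
      have hmem2 : |(rot θ p).1| ≤ α ∧ |(rot θ p).2| ≤ α := by
        constructor
        · calc |Real.cos θ * p.1 - Real.sin θ * p.2|
              ≤ |Real.cos θ| * |p.1| + |Real.sin θ| * |p.2| := by
                rw [← abs_mul, ← abs_mul]; exact abs_sub _ _
            _ ≤ 1 * (α / (1 + |θ|)) + |θ| * (α / (1 + |θ|)) := by
                gcongr
                · exact hp.1
                · exact hp.2
            _ = α := by rw [one_mul, hR]
        · calc |Real.sin θ * p.1 + Real.cos θ * p.2|
              ≤ |Real.sin θ| * |p.1| + |Real.cos θ| * |p.2| := by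
                rw [← abs_mul, ← abs_mul]; exact abs_add_le _ _
            _ ≤ |θ| * (α / (1 + |θ|)) + 1 * (α / (1 + |θ|)) := by
                gcongr
                · exact hp.1
                · exact hp.2
            _ = α := by rw [one_mul, add_comm, hR]
      have e1 : template (α / (1 + |θ|)) p = 1 := template_eq_one hp
      have e2 : rotTemplate α θ p = 1 := template_eq_one hmem2
      have e3 : template α p = 1 := template_eq_one hmem1
      simp only [e1, e2, e3, mul_one, le_refl]
    · have e1 : template (α / (1 + |θ|)) p = 0 := by
        rw [template]
        exact Set.indicator_of_notMem
          (s := {p : ℝ × ℝ | |p.1| ≤ α / (1 + |θ|) ∧ |p.2| ≤ α / (1 + |θ|)}) hp fun _ => (1 : ℝ)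
      simp only [e1]
      exact hnn
  have hexp : ∀ p, (rotTemplate α θ p - template α p) ^ 2 =
      rotTemplate α θ p ^ 2 + template α p ^ 2 - 2 * (rotTemplate α θ p * template α p) :=
    fun p => by ring
  have i12 : Integrable (fun p => rotTemplate α θ p ^ 2 + template α p ^ 2) volume := i1.add i2
  simp only [hexp]
  rw [integral_sub i12 (i3.const_mul 2), integral_add i1 i2, integral_const_mul,
    integral_rotTemplate_sq hα, v2]
  have hfin : 1 - 2 * |θ| ≤ 2 * (α / (1 + |θ|)) ^ 2 := by
    rw [div_pow, hα2, mul_div_assoc', le_div_iff₀ (by positivity)]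
    nlinarith [mul_nonneg hθ (sq_nonneg |θ|), sq_nonneg |θ|]
  rw [hsmall] at hle
  linarith

/-- The rank-one operator `f ↦ ⟪u, f⟫ u`. -/
def rankOneOp (u : L2) : L2 →L[ℝ] L2 := (innerSL ℝ u).smulRight u

theorem rankOneOp_apply (u f : L2) : rankOneOp u f = ⟪u, f⟫_ℝ • u := rfl

theorem adjoint_rankOneOp (u : L2) : ContinuousLinearMap.adjoint (rankOneOp u) = rankOneOp u := by
  symm
  rw [ContinuousLinearMap.eq_adjoint_iff]
  intro x y
  rw [rankOneOp_apply, rankOneOp_apply, real_inner_smul_left, real_inner_smul_right,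
    real_inner_comm u x]
  ring

theorem norm_fredholm_sub_rankOneOp_le {α : ℝ} (hα : α = 1 / √2) {θ h : ℝ} (h0 : 0 ≤ h)
    (hθ : 8 * |θ| ≤ h ^ 2) :
    ‖fredholm (rotTemplate α θ) (memLp_rotTemplate α θ) - rankOneOp (pulse α)‖ ≤ h := by
  have hrot0 : rotTemplate α 0 = template α := by
    funext p
    simp [rotTemplate, rot]
  have ht2 : MemLp (template α) 2 volume := hrot0 ▸ memLp_rotTemplate α 0
  have hK : MemLp (fun p => rotTemplate α θ p - template α p) 2 volume :=
    (memLp_rotTemplate α θ).sub ht2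
  have heq : fredholm (rotTemplate α θ) (memLp_rotTemplate α θ) - rankOneOp (pulse α) =
      fredholm _ hK := by
    refine ContinuousLinearMap.ext fun f => ?_
    rw [sub_apply, rankOneOp_apply, inner_pulse]
    refine Lp.ext ?_
    filter_upwards [fredholm_coeFn hK f, fredholm_coeFn (memLp_rotTemplate α θ) f,
      ae_memLp_section (memLp_rotTemplate α θ), ae_memLp_section ht2,
      Lp.coeFn_sub (fredholm (rotTemplate α θ) (memLp_rotTemplate α θ) f)
        ((∫ t in Set.Icc (-α) α, f t) • pulse α),
      Lp.coeFn_smul (∫ t in Set.Icc (-α) α, f t) (pulse α),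
      indicatorConstLp_coeFn (p := 2) (hs := (measurableSet_Icc : MeasurableSet
        (Set.Icc (-α) α))) (hμs := (measure_Icc_lt_top (μ := (volume : Measure ℝ))).ne)
        (c := (1 : ℝ))] with s k1 k2 k3 k4 k5 k6 k7
    rw [k5, Pi.sub_apply, k6, Pi.smul_apply, pulse, k7, k2, k1]
    simp only [sub_mul]
    have i1 : Integrable (fun t => rotTemplate α θ (s, t) * f t) volume :=
      k3.integrable_mul (Lp.memLp f)
    have i2 : Integrable (fun t => template α (s, t) * f t) volume :=
      k4.integrable_mul (Lp.memLp f)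
    rw [integral_sub i1 i2]
    congr 1
    have k8 : ∀ t, template α (s, t) * f t = (Set.Icc (-α) α).indicator (fun _ => (1 : ℝ)) s *
        (Set.Icc (-α) α).indicator f t := by
      intro t
      simp only [template, Set.indicator, Set.mem_Icc, Set.mem_ofPred_eq, ← abs_le]
      by_cases h1 : |s| ≤ α <;> by_cases h2 : |t| ≤ α <;> simp [h1, h2]
    simp only [k8]
    rw [integral_const_mul, integral_indicator measurableSet_Icc, smul_eq_mul, mul_comm]
  rw [heq]
  exact norm_fredholm_le hK h0 ((integral_rotTemplate_sub_sq_le hα θ).trans hθ)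

/-- Near alignment, `𝒯 + 𝒯*` is close to twice the rank-one operator of `pulse α`. -/
theorem norm_symOp_sub_le {α : ℝ} (hα : α = 1 / √2) {νStar ν θ h : ℝ} (h0 : 0 ≤ h)
    (hrot : rotTemplate α (ν - νStar) = rotTemplate α θ) (hθ : 8 * |θ| ≤ h ^ 2) (x : L2) :
    ‖symOp α νStar ν x - (2 * ⟪pulse α, x⟫_ℝ) • pulse α‖ ≤ 2 * h * ‖x‖ := by
  have hT : fredholm (rotTemplate α (ν - νStar)) (memLp_rotTemplate α (ν - νStar)) =
      fredholm (rotTemplate α θ) (memLp_rotTemplate α θ) := by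
    congr 1
  set D := fredholm (rotTemplate α θ) (memLp_rotTemplate α θ) - rankOneOp (pulse α) with hD
  have hDn : ‖D‖ ≤ h := norm_fredholm_sub_rankOneOp_le hα h0 hθ
  have heq : symOp α νStar ν x - (2 * ⟪pulse α, x⟫_ℝ) • pulse α =
      D x + ContinuousLinearMap.adjoint D x := by
    rw [symOp, hT, hD, map_sub, adjoint_rankOneOp, sub_apply,
      sub_apply, add_apply, rankOneOp_apply, two_mul,
      add_smul]
    abel
  rw [heq]
  have h1 : ‖D x‖ ≤ h * ‖x‖ := (D.le_opNorm x).trans (by gcongr)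
  have h2 : ‖ContinuousLinearMap.adjoint D x‖ ≤ h * ‖x‖ :=
    ((ContinuousLinearMap.adjoint D).le_opNorm x).trans
      (by rw [LinearIsometryEquiv.norm_map]; gcongr)
  exact (norm_add_le _ _).trans (by linarith)

/-! ### The refined representation -/

/-- The cone `⟪n, x⟫ ≥ 0.7 ‖x‖` is invariant, so every iterate after the first is at an angle
`O(h)` from `n`. -/
theorem powerIter_succ_near {A : L2 →L[ℝ] L2} {n u₀ : L2} {N h : ℝ} (hn : ‖n‖ = 1)
    (hN : 1.414 ≤ N) (h0 : 0 ≤ h) (h1 : h ≤ 0.177)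
    (hA : ∀ x, ‖A x - (2 * N * ⟪n, x⟫_ℝ) • n‖ ≤ 2 * h * ‖x‖) (hu0 : u₀ ≠ 0)
    (hu : 0.7 * ‖u₀‖ ≤ ⟪n, u₀⟫_ℝ) (k : ℕ) :
    ‖powerIter A u₀ (k + 1)‖ = 1 ∧ 0 < ⟪n, powerIter A u₀ (k + 1)⟫_ℝ ∧
      1 - ⟪n, powerIter A u₀ (k + 1)⟫_ℝ ^ 2 ≤ 25 / 16 * h ^ 2 := by
  induction k with
  | zero => exact normalized_step hn hN h1 hA hu0 hu
  | succ k ih =>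
    obtain ⟨i1, i2, i3⟩ := ih
    refine normalized_step hn hN h1 hA (fun h => ?_) ?_
    · rw [h, norm_zero] at i1
      exact zero_ne_one i1
    · rw [i1]
      have : h ^ 2 ≤ 0.177 ^ 2 := by gcongr
      nlinarith

/-- The power method near alignment recovers `pulse α` up to `O(√ε)`, from any positive multiple of
a vector close to `cosVec`. -/
theorem norm_powerMethod_sub_le {α : ℝ} (hα : α = 1 / √2) {νStar ν θ ε : ℝ} (hε0 : 0 < ε)
    (hε : ε ≤ 1 / 768) (hrot : rotTemplate α (ν - νStar) = rotTemplate α θ) (hθ : |θ| ≤ 3 * ε)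
    {m : ℝ} (hm : 0 < m) {E : L2} (hE : ‖E‖ ≤ 1 / 1000) {k : ℕ} (hk : 1 ≤ k) :
    ‖powerMethod α νStar k (m • (cosVec + E)) ν - pulse α‖ ≤ 31 * √ε := by
  have hpi := Real.pi_pos
  have hsq : √2 * √2 = 2 := Real.mul_self_sqrt (by norm_num)
  have hs0 : 0 < √2 := by positivity
  have hs1 : 1.414 ≤ √2 := by nlinarith
  have hs2 : √2 ≤ 1.415 := by nlinarith
  have hα2 : 2 * α = √2 := by rw [hα]; field_simp; linarith
  have hN := norm_pulse_sq (a := α) (by linarith)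
  rw [hα2] at hN
  have hp0 : 0 < ‖pulse α‖ := by
    refine (norm_nonneg _).lt_of_ne fun h => ?_
    rw [← h] at hN
    norm_num at hN
    linarith
  have hp1 : ‖pulse α‖ ≤ 1.19 := by nlinarith
  have hsN : √(√2) = ‖pulse α‖ := by rw [← hN, Real.sqrt_sq hp0.le]
  set n : L2 := ‖pulse α‖⁻¹ • pulse α with hndef
  have hn : ‖n‖ = 1 := by rw [hndef, norm_smul, norm_inv, norm_norm, inv_mul_cancel₀ hp0.ne']
  have hpn : √(√2) • n = pulse α := by
    rw [hsN, hndef, smul_smul, mul_inv_cancel₀ hp0.ne', one_smul]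
  -- The kernel error has squared norm at most `8 |θ| ≤ 24 ε`.
  set h := √(24 * ε) with hh
  have h0 : 0 ≤ h := Real.sqrt_nonneg _
  have hh2 : h ^ 2 = 24 * ε := Real.sq_sqrt (by positivity)
  have h1 : h ≤ 0.177 := by nlinarith
  have hA : ∀ x, ‖symOp α νStar ν x - (2 * √2 * ⟪n, x⟫_ℝ) • n‖ ≤ 2 * h * ‖x‖ := by
    intro x
    have := norm_symOp_sub_le hα h0 hrot (by rw [hh2]; linarith) x
    convert this using 3
    rw [hndef, real_inner_smul_left, smul_smul, ← hN]
    congr 1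
    field_simp
  have hip : 0.898 ≤ ⟪pulse α, cosVec⟫_ℝ := by
    rw [inner_pulse_cosVec (by linarith) (by linarith)]
    have k1 := Real.mul_le_sin (x := Real.pi / 2 * α) (by nlinarith) (by nlinarith)
    have k2 : 2 / Real.pi * (Real.pi / 2 * α) = α := by field_simp
    rw [k2] at k1
    have k3 : (1.2732 : ℝ) ≤ 4 / Real.pi := by
      rw [le_div_iff₀ hpi]
      linarith [Real.pi_lt_d4]
    calc (0.898 : ℝ) ≤ 1.2732 * α := by linarith
      _ ≤ _ := by gcongr; linarith
  have hin : 0.75 ≤ ⟪n, cosVec + E⟫_ℝ := by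
    have k1 := neg_le_of_abs_le (abs_real_inner_le_norm n E)
    rw [hn, one_mul] at k1
    have k2 : 0.752 ≤ ⟪n, cosVec⟫_ℝ := by
      rw [hndef, real_inner_smul_left, inv_mul_eq_div, le_div_iff₀ hp0]
      linarith
    rw [inner_add_right]
    linarith
  have hnorm : ‖cosVec + E‖ ≤ 1.001 := by
    refine (norm_add_le _ _).trans ?_
    rw [norm_cosVec]
    linarith
  obtain ⟨j, rfl⟩ : ∃ j, k = j + 1 := ⟨k - 1, by omega⟩
  obtain ⟨y1, y2, y3⟩ := powerIter_succ_near (u₀ := m • (cosVec + E)) hn hs1 h0 h1 hA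
    (fun h => by
      have : cosVec + E = 0 := (smul_eq_zero.1 h).resolve_left hm.ne'
      rw [this, inner_zero_right] at hin
      linarith)
    (by
      rw [norm_smul, Real.norm_of_nonneg hm.le, real_inner_smul_right]
      nlinarith) j
  have hfin := norm_rayleigh_sub_sq_le hn hs1 hs2 h1 hA y1 y2 y3
  rw [hpn] at hfin
  rw [powerMethod]
  refine le_of_sq_le_sq (hfin.trans ?_) (by positivity)
  rw [hh2, mul_pow, Real.sq_sqrt hε0.le]
  linarith

end Tilted

end

theorem mainTheorem2 :
    ∃ c₁ C₁ C₂ : ℝ, 0 < c₁ ∧ 0 < C₁ ∧ 0 < C₂ ∧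
      ∀ (α νStar : ℝ), α = 1 / Real.sqrt 2 → νStar = Real.pi / 4 →
      ∀ (σ β ε : ℝ), 0 < σ → σ ^ 2 ≤ 1 / 10 ^ 4 → 0 < β → β ≤ c₁ →
        0 < ε → ε ≤ 1 / 768 →
      ∀ (Trough Tν Tu : ℕ),
        -C₁ * Real.log (σ ^ 2 * ε) ≤ (Trough : ℝ) →
        -(C₂ * Real.log (3 * ε)) / β ≤ (Tν : ℝ) →
        16 ≤ Tu →
        4 / 7 ≤ Tilted.uniformAngle {ν₀ : ℝ |
          min (Tilted.realMod |Tilted.nuHat α νStar σ β Trough Tν ν₀ - νStar| (Real.pi / 2))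
              (Real.pi / 2 -
                Tilted.realMod |Tilted.nuHat α νStar σ β Trough Tν ν₀ - νStar| (Real.pi / 2))
            ≤ 3 * ε ∧
          ‖Tilted.uHat α νStar σ β Trough Tν Tu ν₀ - Tilted.pulse α‖ ≤ 31 * Real.sqrt ε} := by
  refine ⟨1 / 100, 2, 200, by norm_num, by norm_num, by norm_num, ?_⟩
  intro α νStar hα hν σ β ε hσ hσ1 hβ hβ1 hε hε1 Trough Tν Tu hTr hTν hTu
  subst hν
  have hpi := Real.pi_pos
  have hα0 : 0 < α := hα ▸ by positivity
  have hα2 : α ^ 2 = 1 / 2 := by rw [hα, div_pow, Real.sq_sqrt zero_le_two, one_pow]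
  -- The bounds on `σ` and `ε` alone force `log (σ ^ 2 * ε) ≤ -8`.
  have hTrough : 16 ≤ Trough := by
    have hlog : Real.log (σ ^ 2 * ε) ≤ -8 := by
      rw [Real.log_le_iff_le_exp (by positivity), Real.exp_neg,
        le_inv_comm₀ (by positivity) (Real.exp_pos _)]
      -- `e ^ 8 < 3 ^ 8 < 768 * 10 ^ 4`
      have he : Real.exp 8 ≤ 3 ^ 8 := by
        rw [← Real.exp_one_rpow, show (8 : ℝ) = (8 : ℕ) by norm_num, Real.rpow_natCast]
        gcongr
        exact Real.exp_one_lt_three.le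
      refine he.trans ?_
      rw [le_inv_comm₀ (by norm_num) (by positivity)]
      calc σ ^ 2 * ε ≤ 1 / 10 ^ 4 * (1 / 768) := by gcongr
        _ ≤ (3 ^ 8)⁻¹ := by norm_num
    have : (16 : ℝ) ≤ Trough := by linarith
    exact_mod_cast this
  obtain ⟨m, e, E, hprof, hu, huE, hE⟩ := Tilted.exists_isProfile_uRough hα hTrough
  -- It suffices that every start within `π / 7` of an aligned angle succeeds.
  refine Tilted.le_uniformAngle fun j θ₀ hθ₀ => ?_
  rw [Set.mem_ofPred_eq]
  obtain ⟨θ, hθ, hθ1⟩ := Tilted.exists_angleIter_eq hσ hσ1 hβ hβ1 hα2 hα0 (Real.pi / 4) hprof hu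
    j hθ₀ Tν
  have hpow := Tilted.pow_le_of_iterations hβ hβ1 (by positivity : (0 : ℝ) < 3 * ε) hTν
  have hθε : |θ| ≤ 3 * ε := by
    refine hθ1.trans ?_
    have h1 : |θ₀| ≤ 1 := by linarith [Real.pi_le_four]
    have h2 : (0 : ℝ) ≤ 3 * ε := by positivity
    exact (mul_le_mul hpow h1 (abs_nonneg _) h2).trans_eq (mul_one _)
  have hhat : Tilted.nuHat α (Real.pi / 4) σ β Trough Tν (Real.pi / 4 + j * (Real.pi / 2) + θ₀) =
      Real.pi / 4 + j * (Real.pi / 2) + θ := hθ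
  refine ⟨?_, ?_⟩
  · refine (Tilted.min_realMod_abs_le (by positivity) j ?_).trans hθε
    rw [hhat]
    ring
  · rw [Tilted.uHat, hhat, huE]
    refine Tilted.norm_powerMethod_sub_le hα hε hε1 ?_ hθε hprof.pos hE (by omega)
    rw [← (Tilted.rotTemplate_periodic α).int_mul j θ]
    congr 1
    ring
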